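/- Let $\lambda_F,\lambda_R,P_F,P_R,k>0$, $\alpha>2$, $\sigma^2\ge 0$, and let $N_B\ge 2$, $B\ge 0$ be integers. Let $\Phi_F,\Phi_R$ be independent homogeneous Poisson point processes in the plane with densities $\lambda_F,\lambda_R$ (F-APs and RRHs), with the typical user at the origin; $r_x$ is the distance of a point $x$ to the origin, and $x_0,y_0$ are the points of $\Phi_F,\Phi_R$ nearest to the origin. Let the power gains $|h_x|^2$ of all points be i.i.d. exponential with mean $1$ and independent of the positions. Put $\zeta=1-2^B\beta\big(2^B,\tfrac{N_B}{N_B-1}\big)$ with $\beta$ the Beta function, $\upsilon=2^{-B/(N_B-1)}$, and $$\gamma^F=\frac{P_F|h_{x_0}|^2r_{x_0}^{-\alpha}}{\sum_{x\in\Phi_F\setminus\{x_0\}}P_F|h_x|^2r_x^{-\alpha}+\sum_{y\in\Phi_R}P_R|h_y|^2r_y^{-\alpha}+\sigma^2},$$ $$\gamma^R=\frac{P_R\zeta|h_{y_0}|^2r_{y_0}^{-\alpha}}{\sum_{x\in\Phi_F}P_F|h_x|^2r_x^{-\alpha}+\upsilon\sum_{y\in\Phi_R\setminus\{y_0\}}P_R|h_y|^2r_y^{-\alpha}+\sigma^2}.$$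 The user is associated with $x_0$ (event $\mathcal F$) if $k\,r_{x_0}\le r_{y_0}$, and with $y_0$ (event $\mathcal R$) otherwise; for $k=(P_R/P_F)^{1/\alpha}$ this is the max-RSRP association $P_Rr_{y_0}^{-\alpha}\le P_Fr_{x_0}^{-\alpha}$. Let $\mathrm{SINR}=\gamma^F$ on $\mathcal F$ and $\mathrm{SINR}=\gamma^R$ on $\mathcal R$, and for $\delta\ge0$ let $S_F(\delta,\alpha)=P(\gamma^F\ge\delta\mid\mathcal F)$ and $S_R(\delta,\alpha)=P(\gamma^R\ge\delta\mid\mathcal R)$ be the success delivery probabilities. Then almost surely all interference sums converge and both denominators are positive; the association probabilities are $$A_F=P(\mathcal F)=\frac{\lambda_F}{\lambda_F+k^2\lambda_R},\qquad A_R=P(\mathcal R)=\frac{k^2\lambda_R}{\lambda_F+k^2\lambda_R};$$ the average ergodic rate $R(\alpha)=E[\log_2(1+\mathrm{SINR})]$ is finite, $E[\log_2(1+\gamma^F)\mid\mathcal F]=\int_0^\infty S_F(2^t-1,\alpha)\,dt$ and $E[\log_2(1+\gamma^R)\mid\mathcal R]=\int_0^\infty S_R(2^t-1,\alpha)\,dt$,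 both finite, and $$R(\alpha)=A_F\,E[\log_2(1+\gamma^F)\mid\mathcal F]+A_R\,E[\log_2(1+\gamma^R)\mid\mathcal R]=A_F\int_0^\infty S_F(2^t-1,\alpha)\,dt+A_R\int_0^\infty S_R(2^t-1,\alpha)\,dt.$$ In the interference-limited case $\sigma^2=0$, for all $\delta\ge 0$, with $\rho(\delta,\alpha)=\int_{\delta^{-2/\alpha}}^\infty\frac{\delta^{2/\alpha}}{1+u^{\alpha/2}}\,du$ (and $\rho(0,\alpha)=0$), $$S_F(\delta,\alpha)=\frac{\lambda_F+k^2\lambda_R}{\lambda_F(1+\rho(\delta,\alpha))+k^2\lambda_R\big(1+\rho(\tfrac{\delta P_R}{k^\alpha P_F},\alpha)\big)},$$ $$S_R(\delta,\alpha)=\frac{\lambda_F+k^2\lambda_R}{\lambda_F\big(1+\rho(\tfrac{\delta k^\alpha P_F}{\zeta P_R},\alpha)\big)+k^2\lambda_R\big(1+\rho(\tfrac{\upsilon\delta}{\zeta},\alpha)\big)},$$ and $R(\alpha)$ is given by the formula above with these closed forms. -/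

import Mathlib

open MeasureTheory ProbabilityTheory Set

noncomputable section

namespace FRAN

/-- The Euclidean plane; the typical user sits at its origin. -/
abbrev Plane : Type := EuclideanSpace ℝ (Fin 2)

/-- The number (possibly infinite) of points of the enumerated point process `X` in `B`. -/
def count {Ω : Type*} (X : ℕ → Ω → Plane) (B : Set Plane) (ω : Ω) : ENNReal :=
  ∑' n, B.indicator (fun _ => (1 : ENNReal)) (X n ω)

/-- `X` enumerates a homogeneous Poisson point process of density `lam` in the plane: the number of
points in a Borel set `B` of finite area is Poisson with mean `lam * area B`, and the numbers of
points in pairwise disjoint Borel sets are mutually independent. -/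
structure IsPPP {Ω : Type*} [MeasurableSpace Ω] (μ : Measure Ω) (lam : ℝ)
    (X : ℕ → Ω → Plane) : Prop where
  measurable : ∀ n, Measurable (X n)
  poisson : ∀ B : Set Plane, MeasurableSet B → volume B ≠ ⊤ →
    μ.map (count X B) =
      (poissonMeasure (lam * volume.real B).toNNReal).map (fun n : ℕ => (n : ENNReal))
  indep : ∀ (m : ℕ) (B : Fin m → Set Plane), (∀ i, MeasurableSet (B i)) →
    Pairwise (Function.onFun Disjoint B) → iIndepFun (fun i => count X (B i)) μ

/-- The two-tier network. `X` enumerates the F-APs and `Y` the RRHs, each by increasing distance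
from the typical user, so that `X 0` and `Y 0` are the nearest F-AP and RRH; they are independent
homogeneous Poisson processes of densities `lamF`, `lamR`. The power gains `g n`, `h n` (the squared
moduli of the Rayleigh fading coefficients) of the links to `X n`, `Y n` are i.i.d. exponential
with mean one and independent of the positions. -/
structure IsNetwork {Ω : Type*} [MeasurableSpace Ω] (μ : Measure Ω) (lamF lamR : ℝ)
    (X Y : ℕ → Ω → Plane) (g h : ℕ → Ω → ℝ) : Prop where
  pppF : IsPPP μ lamF X
  pppR : IsPPP μ lamR Y
  sortedF : ∀ᵐ ω ∂μ, Monotone (fun n => ‖X n ω‖)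
  sortedR : ∀ᵐ ω ∂μ, Monotone (fun n => ‖Y n ω‖)
  measurable_g : ∀ n, Measurable (g n)
  measurable_h : ∀ n, Measurable (h n)
  exp_g : ∀ n, μ.map (g n) = expMeasure 1
  exp_h : ∀ n, μ.map (h n) = expMeasure 1
  indep_tiers : IndepFun (fun ω n => X n ω) (fun ω n => Y n ω) μ
  indep_gains : iIndepFun (Sum.elim g h : ℕ ⊕ ℕ → Ω → ℝ) μ
  indep_positions_gains :
    IndepFun (fun ω => ((fun n => X n ω), (fun n => Y n ω)))
      (fun ω => ((fun n => g n ω), (fun n => h n ω))) μ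

/-- Quantization coefficient of limited feedback with `NB` antennas and a codebook of size `2 ^ B`:
`ζ = 1 - 2^B β(2^B, NB / (NB - 1))`. -/
def zeta (NB B : ℕ) : ℝ :=
  1 - (2 : ℝ) ^ B * beta ((2 : ℝ) ^ B) ((NB : ℝ) / ((NB : ℝ) - 1))

/-- Interference power coefficient of limited feedback, `υ = 2 ^ (-B / (NB - 1))`. -/
def upsilon (NB B : ℕ) : ℝ := (2 : ℝ) ^ (-(B : ℝ) / ((NB : ℝ) - 1))

section Signal

variable {Ω : Type*} (PF PR α σ2 : ℝ) (NB B : ℕ) (X Y : ℕ → Ω → Plane) (g h : ℕ → Ω → ℝ)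

/-- Interference plus noise of a user served by the nearest F-AP. -/
def noiseF (ω : Ω) : ℝ :=
  (∑' n, PF * g (n + 1) ω * ‖X (n + 1) ω‖ ^ (-α)) + (∑' n, PR * h n ω * ‖Y n ω‖ ^ (-α)) + σ2

/-- SINR of a user served by the nearest F-AP. -/
def sinrF (ω : Ω) : ℝ := PF * g 0 ω * ‖X 0 ω‖ ^ (-α) / noiseF PF PR α σ2 X Y g h ω

/-- Interference plus noise of a user served by the nearest RRH; the interference of the other RRHs
is reduced by the factor `υ`. -/
def noiseR (ω : Ω) : ℝ :=
  (∑' n, PF * g n ω * ‖X n ω‖ ^ (-α)) +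
    upsilon NB B * (∑' n, PR * h (n + 1) ω * ‖Y (n + 1) ω‖ ^ (-α)) + σ2

/-- SINR of a user served by the nearest RRH. -/
def sinrR (ω : Ω) : ℝ :=
  PR * zeta NB B * h 0 ω * ‖Y 0 ω‖ ^ (-α) / noiseR PF PR α σ2 NB B X Y g h ω

/-- The event that the typical user is associated with its nearest F-AP; on the complement it is
associated with its nearest RRH. -/
def assocF (k : ℝ) : Set Ω := {ω | k * ‖X 0 ω‖ ≤ ‖Y 0 ω‖}

open Classical in
/-- SINR of the typical user at the base station with which it is associated. -/
def sinr (k : ℝ) (ω : Ω) : ℝ :=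
  if ω ∈ assocF X Y k then sinrF PF PR α σ2 X Y g h ω else sinrR PF PR α σ2 NB B X Y g h ω

/-- Success delivery probability of a typical user at F-APs: the conditional probability of
`SINR ≥ δ` given association with an F-AP. -/
def successF [MeasurableSpace Ω] (μ : Measure Ω) (k δ : ℝ) : ℝ :=
  (cond μ (assocF X Y k)).real {ω | δ ≤ sinrF PF PR α σ2 X Y g h ω}

/-- Success delivery probability of a typical user at RRHs: the conditional probability of
`SINR ≥ δ` given association with an RRH. -/
def successR [MeasurableSpace Ω] (μ : Measure Ω) (k δ : ℝ) : ℝ :=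
  (cond μ (assocF X Y k)ᶜ).real {ω | δ ≤ sinrR PF PR α σ2 NB B X Y g h ω}

end Signal

/-- With `k = (PR / PF) ^ (1 / α)`, the association rule compares the received powers
`PF * r ^ (-α)` and `PR * s ^ (-α)` of the nearest F-AP and the nearest RRH. -/
theorem mul_le_iff_rsrp {PF PR α r s : ℝ} (hPF : 0 < PF) (hPR : 0 < PR) (hα : 0 < α)
    (hr : 0 < r) (hs : 0 < s) :
    (PR / PF) ^ (1 / α) * r ≤ s ↔ PR * s ^ (-α) ≤ PF * r ^ (-α) := by
  have hk : 0 < (PR / PF) ^ (1 / α) := by positivity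
  rw [← Real.rpow_le_rpow_iff (by positivity) hs.le hα, Real.mul_rpow hk.le hr.le,
    ← Real.rpow_mul (by positivity), one_div_mul_cancel hα.ne', Real.rpow_one,
    Real.rpow_neg hs.le, Real.rpow_neg hr.le, ← div_eq_mul_inv, ← div_eq_mul_inv,
    div_le_div_iff₀ (by positivity) (by positivity), div_mul_eq_mul_div,
    div_le_iff₀ hPF, mul_comm (s ^ α)]

/-- Association probability at F-APs. -/
def probF (lamF lamR k : ℝ) : ℝ := lamF / (lamF + k ^ 2 * lamR)

/-- Association probability at RRHs. -/
def probR (lamF lamR k : ℝ) : ℝ := k ^ 2 * lamR / (lamF + k ^ 2 * lamR)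

/-- `ρ(δ, α) = ∫_{δ^(-2/α)}^∞ δ^(2/α) / (1 + u^(α/2)) du`. -/
def rho (δ α : ℝ) : ℝ :=
  ∫ u in Ioi (δ ^ (-2 / α)), δ ^ (2 / α) / (1 + u ^ (α / 2))

/-- Interference-limited success delivery probability at F-APs, in closed form. -/
def closedF (lamF lamR PF PR k δ α : ℝ) : ℝ :=
  (lamF + k ^ 2 * lamR) /
    (lamF * (1 + rho δ α) + k ^ 2 * lamR * (1 + rho (δ * PR / (k ^ α * PF)) α))

/-- Interference-limited success delivery probability at RRHs, in closed form. -/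
def closedR (lamF lamR PF PR k : ℝ) (NB B : ℕ) (δ α : ℝ) : ℝ :=
  (lamF + k ^ 2 * lamR) /
    (lamF * (1 + rho (δ * k ^ α * PF / (zeta NB B * PR)) α) +
      k ^ 2 * lamR * (1 + rho (upsilon NB B * δ / zeta NB B) α))

end FRAN

end

/-! Without noise and with the positions fixed, divide the SINR by the path loss of the serving
point: coverage at level `δ` says that one exponential gain exceeds a weighted sum of independent
exponential gains. As `P(g ≥ z) = exp (-z)`, its probability is the Laplace transform of that sum, a
product of factors `1 / (1 + c i)` over the interfering points (`measure_tsum_le_gain`). Averaging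
over the independent positions, coverage together with association has probability equal to the
expectation of `exp (-load)` on the association event (`IsNetwork.measure_inter_interf`).

Squared distances turn each tier into a Poisson process on the half-line, of rate `π` times the
density (`IsPPP.isLinePPP`). Heuristically the nearest point sits at `x` with density `c exp (-c
x)`. The rest of its tier contributes `exp (-c x ρ)`. The other tier has no point below `κ x` and is
thinned beyond, which contributes `exp (-d κ x (1 + ρ'))`. The integral of `c exp (-D x)` is `c /
D`, the closed form.

The proof avoids conditioning on the nearest point. It cuts the half-line into rings `(q ^ i, q ^ (i
+ 1)]` and, on each ring, bounds the load above and below by sums of deterministic weights, to which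
the Laplace functional applies; an infinite weight forbids points in a region. The bounds add up to
Riemann sums of `c exp (-D x)`, and `q → 1` closes the gap (`setLIntegral_expNeg_load`).

The remaining claims are consequences. Threshold zero gives the association probabilities.
Thresholds tending to zero show that the interference converges, because coverage forces it to be
finite. Since `1 + ρ(a) ≥ a ^ (2 / α) / 2`, coverage at level `2 ^ t - 1` decays exponentially in
`t`, so the rate is finite; noise only lowers the SINR. The layer-cake formula turns mean rates into
integrals of coverage. RRHs are handled by exchanging the tiers and inverting `κ = k ^ 2`. -/

noncomputable section

namespace FRAN

open Filter Topology

/-! ### The exponential on `[0, ∞]` and Poisson variables -/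

/-- The function `x ↦ exp (-x)` on `[0, ∞]`, with value `0` at `∞`. -/
def expNeg (x : ENNReal) : ENNReal := EReal.exp (-(x : EReal))

lemma expNeg_ofReal {x : ℝ} (hx : 0 ≤ x) :
    expNeg (ENNReal.ofReal x) = ENNReal.ofReal (Real.exp (-x)) := by
  rw [expNeg, EReal.coe_ennreal_ofReal, max_eq_left hx, ← EReal.coe_neg, EReal.exp_coe]

@[simp] lemma expNeg_top : expNeg ⊤ = 0 := by simp [expNeg]

@[simp] lemma expNeg_zero : expNeg 0 = 1 := by simp [expNeg]

lemma expNeg_antitone : Antitone expNeg := fun x y h => by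
  unfold expNeg
  exact EReal.exp_monotone (EReal.neg_le_neg_iff.2 (EReal.coe_ennreal_le_coe_ennreal_iff.2 h))

lemma expNeg_le_one (x : ENNReal) : expNeg x ≤ 1 := by
  rw [← expNeg_zero]; exact expNeg_antitone (zero_le)

lemma continuous_expNeg : Continuous expNeg :=
  ENNReal.continuous_exp.comp (continuous_neg.comp continuous_coe_ennreal_ereal)

lemma measurable_expNeg : Measurable expNeg := continuous_expNeg.measurable

lemma expNeg_add (x y : ENNReal) : expNeg (x + y) = expNeg x * expNeg y := by
  induction x with
  | top => simp
  | coe x =>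
    induction y with
    | top => simp
    | coe y =>
      rw [← ENNReal.ofReal_coe_nnreal, ← ENNReal.ofReal_coe_nnreal,
        ← ENNReal.ofReal_add x.coe_nonneg y.coe_nonneg, expNeg_ofReal (by positivity),
        expNeg_ofReal x.coe_nonneg, expNeg_ofReal y.coe_nonneg, ← ENNReal.ofReal_mul (Real.exp_nonneg _), ← Real.exp_add]
      congr 2; ring

lemma expNeg_sum {ι : Type*} (s : Finset ι) (f : ι → ENNReal) :
    expNeg (∑ i ∈ s, f i) = ∏ i ∈ s, expNeg (f i) := by
  classical
  induction s using Finset.induction_on with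
  | empty => simp
  | insert i s hi ih => rw [Finset.sum_insert hi, Finset.prod_insert hi, expNeg_add, ih]

/-- Up to the factor `exp (-r (1 - exp (-c)))`, the summands are the weights of the Poisson law of
mean `r exp (-c)`, which sum to one. -/
lemma lintegral_expNeg_poisson (r : NNReal) {c : ENNReal} (hc : c ≠ ⊤) :
    ∫⁻ n : ℕ, expNeg (c * n) ∂(poissonMeasure r) = expNeg (r * (1 - expNeg c)) := by
  lift c to NNReal using hc
  have h1 : ∀ n : ℕ, expNeg ((c : ENNReal) * n) = ENNReal.ofReal (Real.exp (-(c * n))) := by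
    intro n
    rw [← expNeg_ofReal (by positivity)]
    congr 1
    rw [ENNReal.ofReal_mul (by positivity)]; simp
  have h2 : (r : ENNReal) * (1 - expNeg c) = ENNReal.ofReal (r * (1 - Real.exp (-c))) := by
    rw [ENNReal.ofReal_mul (by positivity), ENNReal.ofReal_sub _ (Real.exp_nonneg _),
      ← expNeg_ofReal (by positivity)]; simp
  have h3 : 0 ≤ 1 - Real.exp (-(c : ℝ)) := by
    rw [sub_nonneg]; exact Real.exp_le_one_iff.2 (by simp)
  rw [h2, expNeg_ofReal (by positivity), poissonMeasure, lintegral_sum_measure]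
  simp_rw [lintegral_smul_measure, lintegral_dirac, h1, smul_eq_mul]
  have h4 := (hasSum_one_poissonMeasure (r * (Real.exp (-c)).toNNReal)).mul_left
    (Real.exp (-(r * (1 - Real.exp (-c)))))
  rw [mul_one] at h4
  rw [← h4.tsum_eq, ENNReal.ofReal_tsum_of_nonneg (fun n => by positivity) h4.summable]
  refine tsum_congr fun n => ?_
  rw [← ENNReal.ofReal_mul (by positivity)]
  congr 1
  have : Real.exp (-((c : ℝ) * n)) = Real.exp (-c) ^ n := by
    rw [← Real.exp_nat_mul]; congr 1; ring
  rw [this, NNReal.coe_mul, Real.coe_toNNReal _ (Real.exp_nonneg _), mul_pow]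
  have : Real.exp (-(r : ℝ)) = Real.exp (-(r * (1 - Real.exp (-c)))) *
      Real.exp (-(r * Real.exp (-c))) := by rw [← Real.exp_add]; congr 1; ring
  rw [this]; ring

lemma measurable_count {Ω : Type*} [MeasurableSpace Ω] {X : ℕ → Ω → Plane}
    (hX : ∀ n, Measurable (X n)) {B : Set Plane} (hB : MeasurableSet B) :
    Measurable (count X B) := by
  unfold count
  exact Measurable.tsum fun n => (measurable_const.indicator hB).comp (hX n)

lemma measurable_tsum_comp {Ω E : Type*} [MeasurableSpace Ω] [MeasurableSpace E]
    {X : ℕ → Ω → E} (hX : ∀ n, Measurable (X n)) {f : E → ENNReal} (hf : Measurable f) :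
    Measurable (fun ω => ∑' n, f (X n ω)) :=
  Measurable.tsum fun n => hf.comp (hX n)

/-- Monotone convergence for the counting measure. -/
lemma tendsto_tsum_of_monotone {f : ℕ → ℕ → ENNReal} {F : ℕ → ENNReal}
    (hm : ∀ n, Monotone (fun k => f k n)) (hF : ∀ n, Tendsto (fun k => f k n) atTop (𝓝 (F n))) :
    Tendsto (fun k => ∑' n, f k n) atTop (𝓝 (∑' n, F n)) := by
  simp_rw [← lintegral_count]
  exact lintegral_tendsto_of_tendsto_of_monotone (fun _ => (measurable_of_countable _).aemeasurable)
    (ae_of_all _ hm) (ae_of_all _ hF)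

/-! ### Laplace functional of a planar Poisson process -/

section Laplace

variable {Ω : Type*} [MeasurableSpace Ω] {μ : Measure Ω} {lam : ℝ} {X : ℕ → Ω → Plane}

lemma IsPPP.lintegral_expNeg_count (hX : IsPPP μ lam X) (hl : 0 ≤ lam) {B : Set Plane}
    (hB : MeasurableSet B) (hv : volume B ≠ ⊤) {c : ENNReal} (hc : c ≠ ⊤) :
    ∫⁻ ω, expNeg (c * count X B ω) ∂μ =
      expNeg (ENNReal.ofReal lam * ((1 - expNeg c) * volume B)) := by
  have hm : Measurable (fun x : ENNReal => expNeg (c * x)) :=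
    measurable_expNeg.comp (measurable_const.mul measurable_id)
  rw [← lintegral_map (f := fun x => expNeg (c * x)) hm (measurable_count hX.measurable hB),
    hX.poisson B hB hv, lintegral_map hm (measurable_of_countable _),
    lintegral_expNeg_poisson _ hc]
  congr 1
  have : ((lam * volume.real B).toNNReal : ENNReal) = ENNReal.ofReal lam * volume B := by
    rw [← ENNReal.ofReal, ENNReal.ofReal_mul hl, Measure.real, ENNReal.ofReal_toReal hv]
  rw [this]; ring

/-- The sum over points is a finite combination of the counts in the disjoint fibres of `F`. These
counts are independent, so the expectation factors into Poisson Laplace transforms. -/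
lemma IsPPP.lintegral_expNeg_simpleFunc (hX : IsPPP μ lam X) (hl : 0 ≤ lam)
    (F : SimpleFunc Plane ENNReal) (hF : ∀ x, F x ≠ ⊤)
    (hv : ∀ y, y ≠ 0 → volume (F ⁻¹' {y}) ≠ ⊤) :
    ∫⁻ ω, expNeg (∑' n, F (X n ω)) ∂μ =
      expNeg (ENNReal.ofReal lam * ∫⁻ x, (1 - expNeg (F x))) := by
  classical
  -- The value `0` is left out: its fibre may have infinite area, and it contributes nothing to
  -- either side.
  set J : Finset ENNReal := F.range.filter (· ≠ 0) with hJ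
  have hJ0 : ∀ y ∈ J, y ≠ 0 := fun y hy => (Finset.mem_filter.1 hy).2
  have hJt : ∀ y ∈ J, y ≠ ⊤ := by
    intro y hy
    obtain ⟨x, rfl⟩ := SimpleFunc.mem_range.1 (Finset.mem_filter.1 hy).1
    exact hF x
  -- Used with `φ = id` for the sum over points and with `φ y = 1 - expNeg y` for the area integral.
  have hdec : ∀ (φ : ENNReal → ENNReal), φ 0 = 0 → ∀ x, φ (F x) =
      ∑ y ∈ J, φ y * (F ⁻¹' {y}).indicator (fun _ => (1 : ENNReal)) x := by
    intro φ hφ x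
    by_cases hx : F x = 0
    · rw [hx, hφ, Finset.sum_eq_zero]
      intro y hy
      have : x ∉ F ⁻¹' {y} := by
        simp only [mem_preimage, mem_singleton_iff, hx]; exact (hJ0 y hy).symm
      simp [this]
    · have hxJ : F x ∈ J := Finset.mem_filter.2 ⟨F.mem_range_self x, hx⟩
      rw [Finset.sum_eq_single_of_mem _ hxJ]
      · simp
      · intro y _ hy
        have : x ∉ F ⁻¹' {y} := by
          simp only [mem_preimage, mem_singleton_iff]; exact hy.symm
        simp [this]
  have hmB : ∀ y, MeasurableSet (F ⁻¹' {y}) := fun y => F.measurableSet_fiber y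
  have hsum : ∀ ω, ∑' n, F (X n ω) = ∑ y ∈ J, y * count X (F ⁻¹' {y}) ω := by
    intro ω
    have h0 : ∀ x, F x = _ := hdec id rfl
    simp_rw [h0, id, count]
    rw [Summable.tsum_finsetSum fun _ _ => ENNReal.summable]
    exact Finset.sum_congr rfl fun y _ => ENNReal.tsum_mul_left
  have hint : ∫⁻ x, (1 - expNeg (F x)) = ∑ y ∈ J, (1 - expNeg y) * volume (F ⁻¹' {y}) := by
    simp_rw [hdec (fun y => 1 - expNeg y) (by simp)]
    rw [lintegral_finsetSum J (f := fun y x => (1 - expNeg y) *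
      (F ⁻¹' {y}).indicator (fun _ => (1 : ENNReal)) x)
      fun y _ => measurable_const.mul (measurable_const.indicator (hmB y))]
    refine Finset.sum_congr rfl fun y _ => ?_
    rw [lintegral_const_mul _ (measurable_const.indicator (hmB y)), lintegral_indicator (hmB y)]
    simp
  let e := J.equivFin
  have hind : iIndepFun (fun i : Fin J.card => count X (F ⁻¹' {((e.symm i : J) : ENNReal)})) μ := by
    refine hX.indep _ _ (fun i => hmB _) fun i j hij => ?_
    rw [Function.onFun, Set.disjoint_left]
    intro x hx hy
    simp only [mem_preimage, mem_singleton_iff] at hx hy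
    exact hij (e.symm.injective (Subtype.ext (hx.symm.trans hy)))
  have hind' := hind.comp (fun i x => expNeg (((e.symm i : J) : ENNReal) * x))
    (fun i => measurable_expNeg.comp (measurable_const.mul measurable_id))
  have key := lintegral_prod_eq_prod_lintegral_of_indepFun Finset.univ _ hind'
    (fun i => (measurable_expNeg.comp (measurable_const.mul measurable_id)).comp
      (measurable_count hX.measurable (hmB _)))
  have hfin : ∀ φ : ENNReal → ENNReal, ∏ y ∈ J, φ y = ∏ i, φ (e.symm i : J) := by
    intro φ
    rw [← Finset.prod_coe_sort J φ]
    exact (Equiv.prod_comp e.symm (fun y : J => φ y)).symm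
  simp_rw [hsum, hint, expNeg_sum, Finset.mul_sum, expNeg_sum]
  rw [hfin]
  simp_rw [hfin (fun y => expNeg (y * count X (F ⁻¹' {y}) _))]
  refine key.trans (Finset.prod_congr rfl fun i _ => ?_)
  exact hX.lintegral_expNeg_count hl (hmB _) (hv _ (hJ0 _ (e.symm i).2)) (hJt _ (e.symm i).2)

/-- The Laplace functional of a homogeneous Poisson point process. -/
theorem IsPPP.lintegral_expNeg_tsum [IsProbabilityMeasure μ] (hX : IsPPP μ lam X) (hl : 0 ≤ lam)
    {f : Plane → ENNReal} (hf : Measurable f) :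
    ∫⁻ ω, expNeg (∑' n, f (X n ω)) ∂μ =
      expNeg (ENNReal.ofReal lam * ∫⁻ x, (1 - expNeg (f x))) := by
  -- Cutting off to a ball gives the nonzero fibres finite area; `eapprox` takes only finite values.
  -- The approximation is still monotone with limit `f`.
  let F : ℕ → SimpleFunc Plane ENNReal := fun k =>
    (SimpleFunc.eapprox f k).restrict (Metric.ball 0 k)
  have hFapp : ∀ k x, F k x = (Metric.ball (0 : Plane) k).indicator (SimpleFunc.eapprox f k) x :=
    fun k x => by rw [SimpleFunc.restrict_apply _ measurableSet_ball]
  have hFm : ∀ x, Monotone (fun k => F k x) := by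
    intro x i j hij
    simp only [hFapp]
    refine (Set.indicator_le_indicator (SimpleFunc.monotone_eapprox f hij x)).trans ?_
    exact Set.indicator_le_indicator_of_subset (Metric.ball_subset_ball (by exact_mod_cast hij))
      (fun _ => zero_le) x
  have hFt : ∀ x, Tendsto (fun k => F k x) atTop (𝓝 (f x)) := by
    intro x
    have h1 : Tendsto (fun k => SimpleFunc.eapprox f k x) atTop (𝓝 (f x)) := by
      rw [← SimpleFunc.iSup_eapprox_apply hf x]
      exact tendsto_atTop_iSup fun i j hij => SimpleFunc.monotone_eapprox f hij x
    refine h1.congr' ?_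
    obtain ⟨N, hN⟩ := exists_nat_gt ‖x‖
    filter_upwards [eventually_ge_atTop N] with k hk
    rw [hFapp, Set.indicator_of_mem]
    simp only [Metric.mem_ball, dist_zero_right]
    exact hN.trans_le (by exact_mod_cast hk)
  have hstep : ∀ k, ∫⁻ ω, expNeg (∑' n, F k (X n ω)) ∂μ =
      expNeg (ENNReal.ofReal lam * ∫⁻ x, (1 - expNeg (F k x))) := by
    intro k
    refine hX.lintegral_expNeg_simpleFunc hl _ (fun x => ?_) fun y hy => ?_
    · rw [hFapp]
      by_cases hx : x ∈ Metric.ball (0 : Plane) k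
      · rw [Set.indicator_of_mem hx]; exact (SimpleFunc.eapprox_lt_top f k x).ne
      · rw [Set.indicator_of_notMem hx]; simp
    · refine ((measure_mono ?_).trans_lt (measure_ball_lt_top (x := (0 : Plane)) (r := k))).ne
      intro x hx
      by_contra hxb
      rw [mem_preimage, mem_singleton_iff, hFapp, Set.indicator_of_notMem hxb] at hx
      exact hy hx.symm
  have hL : Tendsto (fun k => ∫⁻ ω, expNeg (∑' n, F k (X n ω)) ∂μ) atTop
      (𝓝 (∫⁻ ω, expNeg (∑' n, f (X n ω)) ∂μ)) := by
    refine tendsto_lintegral_of_dominated_convergence (fun _ => 1)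
      (fun k => measurable_expNeg.comp (measurable_tsum_comp hX.measurable (F k).measurable))
      (fun k => ae_of_all _ fun ω => expNeg_le_one _) (by simp) (ae_of_all _ fun ω => ?_)
    exact (continuous_expNeg.tendsto _).comp
      (tendsto_tsum_of_monotone (fun n => hFm _) (fun n => hFt _))
  have hR : Tendsto (fun k => ∫⁻ x, (1 - expNeg (F k x))) atTop
      (𝓝 (∫⁻ x, (1 - expNeg (f x)))) := by
    refine lintegral_tendsto_of_tendsto_of_monotone
      (fun k => (measurable_const.sub (measurable_expNeg.comp (F k).measurable)).aemeasurable)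
      (ae_of_all _ fun x i j hij => tsub_le_tsub_left (expNeg_antitone (hFm x hij)) _)
      (ae_of_all _ fun x => ?_)
    exact ENNReal.Tendsto.sub tendsto_const_nhds ((continuous_expNeg.tendsto _).comp (hFt x))
      (Or.inl ENNReal.one_ne_top)
  refine tendsto_nhds_unique hL ?_
  simp_rw [hstep]
  exact (continuous_expNeg.tendsto _).comp
    (ENNReal.Tendsto.const_mul hR (Or.inr ENNReal.ofReal_ne_top))

end Laplace

/-! ### Squared distances as a process on the half-line -/

/-- The enumerated point process `T` on `(0, ∞)` has the Laplace functional of a homogeneous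
Poisson process of rate `c`. -/
structure IsLinePPP {Ω : Type*} [MeasurableSpace Ω] (μ : Measure Ω) (c : ℝ)
    (T : ℕ → Ω → ℝ) : Prop where
  measurable : ∀ n, Measurable (T n)
  laplace : ∀ f : ℝ → ENNReal, Measurable f → ∫⁻ ω, expNeg (∑' n, f (T n ω)) ∂μ =
    expNeg (ENNReal.ofReal c * ∫⁻ x in Ioi 0, (1 - expNeg (f x)))

/-- The disc of squared radius `b` has area `π b`; hence the two measures agree on half-open
intervals, which determine them. -/
lemma map_norm_sq_volume :
    (volume : Measure Plane).map (fun x => ‖x‖ ^ 2) =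
      ENNReal.ofReal Real.pi • (volume : Measure ℝ).restrict (Ioi 0) := by
  have hm : Measurable (fun x : Plane => ‖x‖ ^ 2) := by fun_prop
  have hball : ∀ b : ℝ, (volume : Measure Plane) {x | ‖x‖ ^ 2 ≤ b} =
      ENNReal.ofReal Real.pi * ENNReal.ofReal b := by
    intro b
    rcases lt_or_ge b 0 with hb | hb
    · have : {x : Plane | ‖x‖ ^ 2 ≤ b} = ∅ := by
        ext x; simp only [mem_ofPred_eq, mem_empty_iff_false, iff_false, not_le]
        exact hb.trans_le (sq_nonneg _)
      rw [this, ENNReal.ofReal_of_nonpos hb.le]; simp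
    · have : {x : Plane | ‖x‖ ^ 2 ≤ b} = Metric.closedBall 0 (√b) := by
        ext x
        simp only [mem_ofPred_eq, Metric.mem_closedBall, dist_zero_right]
        rw [Real.le_sqrt (norm_nonneg _) hb]
      rw [this, EuclideanSpace.volume_closedBall, Fintype.card_fin,
        ← ENNReal.ofReal_pow (Real.sqrt_nonneg _), Real.sq_sqrt hb, Real.sq_sqrt Real.pi_pos.le,
        mul_comm]
      norm_num [Real.Gamma_two]
  refine Eq.symm (Measure.ext_of_Ioc' _ _ (fun a b hab => ?_) fun a b hab => ?_)
  · rw [Measure.smul_apply, smul_eq_mul]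
    refine ENNReal.mul_ne_top ENNReal.ofReal_ne_top ?_
    rw [Measure.restrict_apply measurableSet_Ioc, Ioc_inter_Ioi, Real.volume_Ioc]
    exact ENNReal.ofReal_ne_top
  · rw [Measure.smul_apply, smul_eq_mul, Measure.map_apply hm measurableSet_Ioc,
      Measure.restrict_apply measurableSet_Ioc, Ioc_inter_Ioi, Real.volume_Ioc]
    have : (fun x : Plane => ‖x‖ ^ 2) ⁻¹' Ioc a b =
        {x : Plane | ‖x‖ ^ 2 ≤ b} \ {x : Plane | ‖x‖ ^ 2 ≤ a} := by
      ext x; simp [and_comm]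
    have hsub : {x : Plane | ‖x‖ ^ 2 ≤ a} ⊆ {x : Plane | ‖x‖ ^ 2 ≤ b} :=
      fun x (hx : ‖x‖ ^ 2 ≤ a) => (hx.trans hab.le : ‖x‖ ^ 2 ≤ b)
    have hfin : (volume : Measure Plane) {x | ‖x‖ ^ 2 ≤ a} ≠ ⊤ := by
      rw [hball]; exact ENNReal.mul_ne_top ENNReal.ofReal_ne_top ENNReal.ofReal_ne_top
    rw [this, measure_sdiff hsub (measurableSet_le hm measurable_const).nullMeasurableSet hfin,
      hball, hball, ← ENNReal.mul_sub (fun _ _ => ENNReal.ofReal_ne_top)]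
    congr 1
    rcases le_total a 0 with ha | ha
    · rw [sup_eq_right.2 ha, ENNReal.ofReal_of_nonpos ha]; simp
    · rw [sup_eq_left.2 ha, ENNReal.ofReal_sub _ ha]

/-- The squared distances to the origin of a planar homogeneous Poisson process form a
homogeneous Poisson process on the half-line. -/
theorem IsPPP.isLinePPP {Ω : Type*} [MeasurableSpace Ω] {μ : Measure Ω} [IsProbabilityMeasure μ]
    {lam : ℝ} {X : ℕ → Ω → Plane} (hX : IsPPP μ lam X) (hl : 0 ≤ lam) :
    IsLinePPP μ (lam * Real.pi) (fun n ω => ‖X n ω‖ ^ 2) where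
  measurable n := (hX.measurable n).norm.pow_const 2
  laplace f hf := by
    have hm : Measurable (fun x : Plane => ‖x‖ ^ 2) := by fun_prop
    rw [hX.lintegral_expNeg_tsum hl (f := fun x => f (‖x‖ ^ 2)) (hf.comp hm),
      ← lintegral_map (f := fun x => 1 - expNeg (f x))
        (measurable_const.sub (measurable_expNeg.comp hf)) hm,
      map_norm_sq_volume, lintegral_smul_measure, smul_eq_mul, ENNReal.ofReal_mul hl, mul_assoc]

/-! ### Attenuation exponents and mean thinning -/

/-- The exponent `log (1 + a (s / u) ^ p)`, for which `exp (-attn a p s u) = 1 / (1 + a (s / u) ^ p)`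
is the Laplace transform of an exponential gain at `a (s / u) ^ p`. -/
def attn (a p s u : ℝ) : ENNReal := ENNReal.ofReal (Real.log (1 + a * (s / u) ^ p))

lemma measurable_attn_right (a p s : ℝ) : Measurable (attn a p s) := by
  unfold attn; fun_prop

lemma expNeg_attn {a p s u : ℝ} (ha : 0 ≤ a) (hs : 0 ≤ s) (hu : 0 ≤ u) :
    expNeg (attn a p s u) = ENNReal.ofReal (1 + a * (s / u) ^ p)⁻¹ := by
  have h : 0 ≤ a * (s / u) ^ p := by positivity
  rw [attn, expNeg_ofReal (Real.log_nonneg (by linarith)), Real.exp_neg,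
    Real.exp_log (by linarith)]

lemma attn_mono {a p s t u : ℝ} (ha : 0 ≤ a) (hp : 0 ≤ p) (hs : 0 ≤ s) (hst : s ≤ t)
    (hu : 0 ≤ u) : attn a p s u ≤ attn a p t u := by
  unfold attn
  have : 0 ≤ a * (s / u) ^ p := by positivity
  gcongr

/-- A bound independent of the positions; it supplies the constant weight inside a ring in the lower
estimate. -/
lemma attn_le_log {a p s u : ℝ} (ha : 0 ≤ a) (hp : 0 ≤ p) (hs : 0 ≤ s) (hsu : s ≤ u) :
    attn a p s u ≤ ENNReal.ofReal (Real.log (1 + a)) := by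
  unfold attn
  have h0 : 0 ≤ u := hs.trans hsu
  have : 0 ≤ a * (s / u) ^ p := by positivity
  have h1 : (s / u) ^ p ≤ 1 :=
    Real.rpow_le_one (by positivity) (div_le_one_of_le₀ hsu h0) hp
  refine ENNReal.ofReal_le_ofReal (Real.log_le_log (by linarith) ?_)
  nlinarith

/-- The mean thinning `∫_1^∞ a / (a + v ^ p) dv`. -/
def excess (a p : ℝ) : ENNReal := ∫⁻ v in Ioi (1 : ℝ), ENNReal.ofReal (a / (a + v ^ p))

/-- Drop `a` from the denominator. The bound is linear in `a`, so the thinning vanishes as `a → 0`.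
-/
lemma excess_le {a p : ℝ} (ha : 0 ≤ a) (hp : 1 < p) :
    excess a p ≤ ENNReal.ofReal (a * (1 / (p - 1))) := by
  have hint := integrableOn_Ioi_rpow_of_lt (show -p < -1 by linarith) one_pos
  have hval := integral_Ioi_rpow_of_lt (show -p < -1 by linarith) one_pos
  have : a * (1 / (p - 1)) = ∫ v in Ioi (1 : ℝ), a * v ^ (-p) := by
    rw [integral_const_mul, hval, Real.one_rpow]
    congr 1
    rw [show -p + 1 = -(p - 1) by ring, neg_div_neg_eq]
  rw [this, ofReal_integral_eq_lintegral_ofReal (hint.const_mul a)]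
  · refine setLIntegral_mono (by fun_prop) fun v hv => ENNReal.ofReal_le_ofReal ?_
    have hv0 : (0 : ℝ) < v := one_pos.trans hv
    rw [Real.rpow_neg hv0.le, ← div_eq_mul_inv]
    have := Real.rpow_pos_of_pos hv0 p
    gcongr
    linarith
  · refine (ae_restrict_mem measurableSet_Ioi).mono fun v hv => ?_
    have hv0 : (0 : ℝ) < v := one_pos.trans hv
    show (0 : ℝ) ≤ a * v ^ (-p)
    positivity

lemma excess_ne_top {a p : ℝ} (ha : 0 ≤ a) (hp : 1 < p) : excess a p ≠ ⊤ :=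
  ((excess_le ha hp).trans_lt ENNReal.ofReal_lt_top).ne

lemma setLIntegral_Ioi_mul {r s : ℝ} (hs : 0 < s) (f : ℝ → ENNReal) (hf : Measurable f) :
    ∫⁻ u in Ioi (s * r), f u = ENNReal.ofReal s * ∫⁻ v in Ioi r, f (s * v) := by
  have h := Real.smul_map_volume_mul_left hs.ne'
  rw [abs_of_pos hs] at h
  rw [← lintegral_indicator measurableSet_Ioi]
  conv_lhs => rw [← h]
  rw [lintegral_smul_measure, lintegral_map (hf.indicator measurableSet_Ioi) (by fun_prop),
    ← lintegral_indicator measurableSet_Ioi, smul_eq_mul]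
  congr 1
  refine lintegral_congr fun v => ?_
  by_cases hv : r < v
  · rw [indicator_of_mem (by simpa [hs] using hv), indicator_of_mem (by simpa using hv)]
  · rw [indicator_of_notMem (by simpa [hs] using hv), indicator_of_notMem (by simpa using hv)]

lemma one_sub_expNeg_attn {a p s v : ℝ} (ha : 0 ≤ a) (hs : 0 < s) (hv : 0 < v) :
    1 - expNeg (attn a p s (s * v)) = ENNReal.ofReal (a / (a + v ^ p)) := by
  have hvp := Real.rpow_pos_of_pos hv p
  rw [expNeg_attn ha hs.le (by positivity), ← ENNReal.ofReal_one,
    ← ENNReal.ofReal_sub _ (by positivity)]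
  congr 1
  have : s / (s * v) = v⁻¹ := by field_simp
  rw [this, Real.inv_rpow hv.le]
  field_simp
  ring

lemma lintegral_attn {a p s : ℝ} (ha : 0 ≤ a) (hs : 0 < s) :
    ∫⁻ u in Ioi s, (1 - expNeg (attn a p s u)) = ENNReal.ofReal s * excess a p := by
  have hm : Measurable fun u => 1 - expNeg (attn a p s u) :=
    measurable_const.sub (measurable_expNeg.comp (measurable_attn_right a p s))
  have h := setLIntegral_Ioi_mul (r := 1) hs _ hm
  rw [mul_one] at h
  rw [h, excess]
  congr 1
  refine setLIntegral_congr_fun measurableSet_Ioi fun v hv => ?_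
  exact one_sub_expNeg_attn ha hs (one_pos.trans hv)

/-- Moves the association factor `κ` from the cutoff radius into the coefficient, so that the
cross-tier integral also starts at its own reference distance. -/
lemma attn_mul {a p κ s u : ℝ} (hκ : 0 < κ) (hs : 0 ≤ s) (hu : 0 ≤ u) :
    attn (a * κ ^ (-p)) p (κ * s) u = attn a p s u := by
  unfold attn
  rw [mul_div_assoc, Real.mul_rpow hκ.le (by positivity), Real.rpow_neg hκ.le]
  have := Real.rpow_pos_of_pos hκ p
  congr 3
  field_simp

lemma lintegral_attn_mul {a p κ s : ℝ} (ha : 0 ≤ a) (hκ : 0 < κ) (hs : 0 < s) :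
    ∫⁻ u in Ioi (κ * s), (1 - expNeg (attn a p s u)) =
      ENNReal.ofReal (κ * s) * excess (a * κ ^ (-p)) p := by
  rw [← lintegral_attn (by positivity) (by positivity)]
  refine setLIntegral_congr_fun measurableSet_Ioi fun u hu => ?_
  rw [attn_mul hκ hs.le]
  exact (show 0 < κ * s by positivity).le.trans (le_of_lt hu)

/-! ### Laplace functionals with the first point in a ring -/

/-- The weight `∞` up to `s`, the constant `c` on `(s, t]` and `w` beyond `t`. -/
def ringWeight (s t : ℝ) (c : ENNReal) (w : ℝ → ENNReal) (u : ℝ) : ENNReal :=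
  if u ≤ s then ⊤ else if u ≤ t then c else w u

lemma measurable_ringWeight (s t : ℝ) (c : ENNReal) {w : ℝ → ENNReal} (hw : Measurable w) :
    Measurable (ringWeight s t c w) :=
  Measurable.ite measurableSet_Iic measurable_const
    (Measurable.ite measurableSet_Iic measurable_const hw)

lemma lintegral_ringWeight {s t : ℝ} (hs : 0 ≤ s) (hst : s ≤ t) (c : ENNReal)
    (w : ℝ → ENNReal) :
    ∫⁻ u in Ioi 0, (1 - expNeg (ringWeight s t c w u)) =
      ENNReal.ofReal s + (1 - expNeg c) * ENNReal.ofReal (t - s) +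
        ∫⁻ u in Ioi t, (1 - expNeg (w u)) := by
  rw [← Ioc_union_Ioi_eq_Ioi (hs.trans hst), ← Ioc_union_Ioc_eq_Ioc hs hst,
    lintegral_union measurableSet_Ioi, lintegral_union measurableSet_Ioc]
  · congr 1
    · congr 1
      · rw [setLIntegral_congr_fun measurableSet_Ioc (g := fun _ => 1)]
        · simp
        · intro u hu; simp [ringWeight, hu.2]
      · rw [setLIntegral_congr_fun measurableSet_Ioc (g := fun _ => 1 - expNeg c)]
        · simp
        · intro u hu; simp [ringWeight, hu.2, not_le.2 hu.1]
    · refine setLIntegral_congr_fun measurableSet_Ioi fun u hu => ?_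
      have hu : t < u := hu
      simp [ringWeight, not_le.2 hu, not_le.2 (hst.trans_lt hu)]
  · exact Set.disjoint_left.2 fun u hu hu' => not_lt.2 hu.2 hu'.1
  · refine Set.disjoint_left.2 fun u hu hu' => ?_
    rcases hu with hu | hu
    · exact not_lt.2 (hu.2.trans hst) hu'
    · exact not_lt.2 hu.2 hu'

lemma le_tsum_comp_zero (f : ℝ → ENNReal) (x : ℕ → ℝ) : f (x 0) ≤ ∑' n, f (x n) :=
  ENNReal.le_tsum 0

/-- The infinite weight thus acts as the indicator that no point lies at or below `s`. -/
lemma expNeg_tsum_ringWeight_of_le {s t : ℝ} {c : ENNReal} {w : ℝ → ENNReal} {x : ℕ → ℝ}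
    (h : x 0 ≤ s) : expNeg (∑' n, ringWeight s t c w (x n)) = 0 := by
  have h1 : ringWeight s t c w (x 0) = ⊤ := by simp [ringWeight, h]
  have h2 := le_tsum_comp_zero (ringWeight s t c w) x
  rw [h1, top_le_iff] at h2
  rw [h2, expNeg_top]

section Line

variable {Ω : Type*} [MeasurableSpace Ω] {μ : Measure Ω} {c : ℝ} {T : ℕ → Ω → ℝ}

lemma IsLinePPP.lintegral_ringWeight (hT : IsLinePPP μ c T) (hc : 0 ≤ c) {s t c₀ W : ℝ}
    (hs : 0 ≤ s) (hst : s ≤ t) (hc₀ : 0 ≤ c₀) (hW : 0 ≤ W) {w : ℝ → ENNReal} (hw : Measurable w)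
    (hwW : ∫⁻ u in Ioi t, (1 - expNeg (w u)) = ENNReal.ofReal W) :
    ∫⁻ ω, expNeg (∑' n, ringWeight s t (ENNReal.ofReal c₀) w (T n ω)) ∂μ =
      ENNReal.ofReal (Real.exp (-(c * (s + (1 - Real.exp (-c₀)) * (t - s) + W)))) := by
  have h1 : 0 ≤ 1 - Real.exp (-c₀) := by
    rw [sub_nonneg]; exact Real.exp_le_one_iff.2 (by linarith)
  have h2 : 0 ≤ t - s := by linarith
  rw [hT.laplace _ (measurable_ringWeight _ _ _ hw), FRAN.lintegral_ringWeight hs hst, hwW,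
    expNeg_ofReal hc₀, ← ENNReal.ofReal_one, ← ENNReal.ofReal_sub _ (Real.exp_nonneg _),
    ← ENNReal.ofReal_mul h1, ← ENNReal.ofReal_add hs (by positivity),
    ← ENNReal.ofReal_add (by positivity) hW, ← ENNReal.ofReal_mul hc, expNeg_ofReal (by positivity)]

/-- The Laplace functional of a Poisson process whose first point lies in `(s, t]`. -/
lemma IsLinePPP.lintegral_ringWeight_first (hT : IsLinePPP μ c T) (hc : 0 ≤ c)
    (hmono : ∀ᵐ ω ∂μ, Monotone fun n => T n ω) {s t c₀ W : ℝ}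
    (hs : 0 ≤ s) (hst : s ≤ t) (hc₀ : 0 ≤ c₀) (hW : 0 ≤ W) {w : ℝ → ENNReal} (hw : Measurable w)
    (hwW : ∫⁻ u in Ioi t, (1 - expNeg (w u)) = ENNReal.ofReal W) :
    ∫⁻ ω, (Ioc s t).indicator
        (fun _ => expNeg (∑' n, ringWeight s t (ENNReal.ofReal c₀) w (T n ω))) (T 0 ω) ∂μ =
      ENNReal.ofReal (Real.exp (-(c * (t + W))) *
        (Real.exp (c * (t - s) * Real.exp (-c₀)) - 1)) := by
  have h1 := hT.lintegral_ringWeight hc hs hst hc₀ hW hw hwW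
  have h2 := hT.lintegral_ringWeight hc (hs.trans hst) le_rfl hc₀ hW hw hwW
  have hm : ∀ s t, Measurable fun ω => expNeg (∑' n, ringWeight s t (ENNReal.ofReal c₀) w (T n ω)) :=
    fun s t => measurable_expNeg.comp
      (measurable_tsum_comp hT.measurable (measurable_ringWeight _ _ _ hw))
  -- "First point in `(s, t]`" is "no point up to `s`" minus "no point up to `t`". When the first
  -- point lies beyond `t` the two weights agree on every point, so the difference vanishes there.
  have hadd : ∀ᵐ ω ∂μ, (Ioc s t).indicator
        (fun _ => expNeg (∑' n, ringWeight s t (ENNReal.ofReal c₀) w (T n ω))) (T 0 ω) +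
      expNeg (∑' n, ringWeight t t (ENNReal.ofReal c₀) w (T n ω)) =
      expNeg (∑' n, ringWeight s t (ENNReal.ofReal c₀) w (T n ω)) := by
    filter_upwards [hmono] with ω hω
    rcases le_or_gt (T 0 ω) t with h | h
    · rw [expNeg_tsum_ringWeight_of_le (x := fun n => T n ω) (s := t) h, add_zero]
      by_cases h' : s < T 0 ω
      · rw [indicator_of_mem (mem_Ioc.2 ⟨h', h⟩)]
      · rw [indicator_of_notMem fun hx => h' hx.1,
          expNeg_tsum_ringWeight_of_le (x := fun n => T n ω) (not_lt.1 h')]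
    · rw [indicator_of_notMem fun hx => not_lt.2 hx.2 h, zero_add]
      congr 1
      refine tsum_congr fun n => ?_
      have : t < T n ω := h.trans_le (hω (Nat.zero_le n))
      simp [ringWeight, not_le.2 this, not_le.2 (hst.trans_lt this)]
  have h3 := lintegral_congr_ae hadd
  rw [lintegral_add_right _ (hm t t), h1, h2] at h3
  have h4 := ENNReal.eq_sub_of_add_eq ENNReal.ofReal_ne_top h3
  rw [h4, ← ENNReal.ofReal_sub _ (Real.exp_nonneg _),
    mul_sub (Real.exp (-(c * (t + W)))), ← Real.exp_add]
  congr 2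
  · congr 1; ring
  · rw [mul_one]; congr 1; ring

/-- Test with the weight `∞` on `(-∞, 0]`: it vanishes on `(0, ∞)`, so the functional equals one and
no point can carry infinite weight. In particular no point of the network sits at the origin. -/
lemma IsLinePPP.ae_pos [IsProbabilityMeasure μ] (hT : IsLinePPP μ c T) :
    ∀ᵐ ω ∂μ, ∀ n, 0 < T n ω := by
  set f : ℝ → ENNReal := (Iic 0).indicator fun _ => ⊤ with hf
  have hfm : Measurable f := measurable_const.indicator measurableSet_Iic
  have h := hT.laplace f hfm
  have h0 : ∫⁻ x in Ioi (0 : ℝ), (1 - expNeg (f x)) = 0 := by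
    rw [setLIntegral_congr_fun measurableSet_Ioi (g := fun _ => 0)]
    · simp
    · intro x hx
      have : x ∉ Iic (0 : ℝ) := fun h => not_lt.2 (mem_Iic.1 h) hx
      simp [hf, this]
  rw [h0, mul_zero, expNeg_zero] at h
  have hm : Measurable fun ω => expNeg (∑' n, f (T n ω)) :=
    measurable_expNeg.comp (measurable_tsum_comp hT.measurable hfm)
  have h1 : (fun ω => expNeg (∑' n, f (T n ω))) =ᵐ[μ] fun _ => 1 :=
    ae_eq_of_ae_le_of_lintegral_le (ae_of_all _ fun ω => expNeg_le_one _) (by rw [h]; simp)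
      aemeasurable_const (by rw [h]; simp)
  filter_upwards [h1] with ω hω n
  by_contra hn
  have h2 : f (T n ω) = ⊤ := by rw [hf, indicator_of_mem]; exact not_lt.1 hn
  have h3 : f (T n ω) ≤ ∑' n, f (T n ω) := ENNReal.le_tsum n
  rw [h2, top_le_iff] at h3
  rw [h3, expNeg_top] at hω
  exact zero_ne_one hω

end Line

/-! ### Geometric rings and Riemann sums -/

lemma iUnion_Ioc_zpow {q : ℝ} (hq : 1 < q) : ⋃ i : ℤ, Ioc (q ^ i) (q ^ (i + 1)) = Ioi 0 := by
  ext x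
  simp only [mem_iUnion, mem_Ioi]
  refine ⟨fun ⟨i, hi⟩ => (zpow_pos (by linarith) i).trans hi.1, fun hx => exists_mem_Ioc_zpow hx hq⟩

lemma pairwise_disjoint_Ioc_zpow_real {q : ℝ} (hq : 1 < q) :
    Pairwise (Function.onFun Disjoint fun i : ℤ => Ioc (q ^ i) (q ^ (i + 1))) := by
  have h : Monotone fun i : ℤ => q ^ i := zpow_right_mono₀ hq.le
  simpa [Order.succ_eq_add_one] using h.pairwise_disjoint_on_Ioc_succ

lemma setLIntegral_Ioi_eq_tsum_zpow {q : ℝ} (hq : 1 < q) (f : ℝ → ENNReal) :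
    ∫⁻ x in Ioi 0, f x = ∑' i : ℤ, ∫⁻ x in Ioc (q ^ i) (q ^ (i + 1)), f x := by
  rw [← iUnion_Ioc_zpow hq, lintegral_iUnion (fun _ => measurableSet_Ioc)
    (pairwise_disjoint_Ioc_zpow_real hq)]

lemma setLIntegral_exp_neg {c D : ℝ} (hc : 0 ≤ c) (hD : 0 < D) :
    ∫⁻ x in Ioi (0 : ℝ), ENNReal.ofReal (c * Real.exp (-D * x)) = ENNReal.ofReal (c / D) := by
  rw [← ofReal_integral_eq_lintegral_ofReal ((integrableOn_exp_mul_Ioi (by linarith) 0).const_mul c)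
    (ae_of_all _ fun x => by positivity), integral_const_mul, integral_exp_mul_Ioi (by linarith)]
  congr 1
  simp
  ring

/-- On a ring `x / q ≤ q ^ i`, so the value at the left end is at most `exp (-(D / q) x)`: the upper
Riemann sum exceeds the integral by a factor of at most `q`. -/
lemma tsum_zpow_exp_le {q c D : ℝ} (hq : 1 < q) (hc : 0 ≤ c) (hD : 0 < D) :
    ∑' i : ℤ, ENNReal.ofReal (c * (q ^ (i + 1) - q ^ i) * Real.exp (-D * q ^ i)) ≤
      ENNReal.ofReal (c * q / D) := by
  have h := setLIntegral_exp_neg hc (show 0 < D / q by positivity)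
  rw [setLIntegral_Ioi_eq_tsum_zpow hq] at h
  rw [show c * q / D = c / (D / q) by field_simp, ← h]
  refine ENNReal.tsum_le_tsum fun i => ?_
  have hqi : 0 < q ^ i := zpow_pos (by linarith) i
  have hle : q ^ i ≤ q ^ (i + 1) := zpow_right_mono₀ hq.le (by omega)
  have h1 : ENNReal.ofReal (c * (q ^ (i + 1) - q ^ i) * Real.exp (-D * q ^ i)) =
      ∫⁻ x in Ioc (q ^ i) (q ^ (i + 1)), ENNReal.ofReal (c * Real.exp (-D * q ^ i)) := by
    rw [setLIntegral_const, Real.volume_Ioc, ← ENNReal.ofReal_mul (by positivity)]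
    congr 1; ring
  rw [h1]
  refine setLIntegral_mono (by fun_prop) fun x hx => ENNReal.ofReal_le_ofReal ?_
  have h2 : x ≤ q ^ i * q := by rw [← zpow_add_one₀ (by linarith)]; exact hx.2
  have h3 : D / q * x ≤ D * q ^ i := by
    rw [div_mul_eq_mul_div, div_le_iff₀ (by linarith), mul_assoc]
    exact mul_le_mul_of_nonneg_left h2 hD.le
  refine mul_le_mul_of_nonneg_left (Real.exp_le_exp.2 ?_) hc
  linarith

/-- Dually, `q ^ (i + 1) ≤ q x` on the ring, and the lower Riemann sum loses at most a factor `q`.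
-/
lemma le_tsum_zpow_exp {q c D : ℝ} (hq : 1 < q) (hc : 0 ≤ c) (hD : 0 < D) :
    ENNReal.ofReal (c / (D * q)) ≤
      ∑' i : ℤ, ENNReal.ofReal (c * (q ^ (i + 1) - q ^ i) * Real.exp (-D * q ^ (i + 1))) := by
  have h := setLIntegral_exp_neg hc (show 0 < D * q by positivity)
  rw [setLIntegral_Ioi_eq_tsum_zpow hq] at h
  rw [← h]
  refine ENNReal.tsum_le_tsum fun i => ?_
  have hqi : 0 < q ^ i := zpow_pos (by linarith) i
  have hle : q ^ i ≤ q ^ (i + 1) := zpow_right_mono₀ hq.le (by omega)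
  have h1 : ENNReal.ofReal (c * (q ^ (i + 1) - q ^ i) * Real.exp (-D * q ^ (i + 1))) =
      ∫⁻ x in Ioc (q ^ i) (q ^ (i + 1)), ENNReal.ofReal (c * Real.exp (-D * q ^ (i + 1))) := by
    rw [setLIntegral_const, Real.volume_Ioc, ← ENNReal.ofReal_mul (by positivity)]
    congr 1; ring
  rw [h1]
  refine setLIntegral_mono (by fun_prop) fun x hx => ENNReal.ofReal_le_ofReal ?_
  have h3 : D * q ^ (i + 1) ≤ D * q * x := by
    rw [zpow_add_one₀ (by linarith), mul_assoc, mul_comm q x]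
    have := hx.1.le
    gcongr
  refine mul_le_mul_of_nonneg_left (Real.exp_le_exp.2 ?_) hc
  linarith

/-! ### Laplace transform of the load at the nearest point -/

/-- The Laplace exponent of the interference seen from the first point of `T`, caused by the other
points of `T` and by the points of `S`. -/
def load {Ω : Type*} (a b p : ℝ) (T S : ℕ → Ω → ℝ) (ω : Ω) : ENNReal :=
  ∑' n, attn a p (T 0 ω) (T (n + 1) ω) + ∑' n, attn b p (T 0 ω) (S n ω)

section Line

variable {Ω : Type*} [MeasurableSpace Ω] {μ : Measure Ω} {c d : ℝ} {T S : ℕ → Ω → ℝ}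

lemma lintegral_first_mul_of_indepFun [IsProbabilityMeasure μ] (hT : ∀ n, Measurable (T n))
    (hS : ∀ n, Measurable (S n)) (hind : IndepFun (fun ω n => T n ω) (fun ω n => S n ω) μ)
    (s t : ℝ) {f g : ℝ → ENNReal} (hf : Measurable f) (hg : Measurable g) :
    ∫⁻ ω, (Ioc s t).indicator (fun _ => expNeg (∑' n, f (T n ω))) (T 0 ω) *
        expNeg (∑' n, g (S n ω)) ∂μ =
      (∫⁻ ω, (Ioc s t).indicator (fun _ => expNeg (∑' n, f (T n ω))) (T 0 ω) ∂μ) *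
        ∫⁻ ω, expNeg (∑' n, g (S n ω)) ∂μ := by
  have h1 : ∀ {f : ℝ → ENNReal}, Measurable f →
      Measurable fun x : ℕ → ℝ => expNeg (∑' n, f (x n)) := fun hf =>
    measurable_expNeg.comp (Measurable.tsum fun n => hf.comp (measurable_pi_apply n))
  have h2 : Measurable fun x : ℕ → ℝ =>
      (Ioc s t).indicator (fun _ => expNeg (∑' n, f (x n))) (x 0) := by
    have : (fun x : ℕ → ℝ => (Ioc s t).indicator (fun _ => expNeg (∑' n, f (x n))) (x 0)) =
        ((fun x : ℕ → ℝ => x 0) ⁻¹' Ioc s t).indicator fun x => expNeg (∑' n, f (x n)) := rfl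
    rw [this]
    exact (h1 hf).indicator (measurable_pi_apply 0 measurableSet_Ioc)
  have h3 := hind.comp h2 (h1 hg)
  exact lintegral_mul_eq_lintegral_mul_lintegral_of_indepFun''
    (h2.comp (measurable_pi_lambda _ hT)).aemeasurable
    ((h1 hg).comp (measurable_pi_lambda _ hS)).aemeasurable h3

/-- With equal radii the ring is empty: the weight only forbids points up to `κ * s` and attenuates
those beyond. -/
lemma IsLinePPP.lintegral_cross (hS : IsLinePPP μ d S) (hd : 0 ≤ d) {b p κ s : ℝ} (hb : 0 ≤ b)
    (hp : 1 < p) (hκ : 0 < κ) (hs : 0 < s) :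
    ∫⁻ ω, expNeg (∑' n, ringWeight (κ * s) (κ * s) (ENNReal.ofReal 0) (attn b p s) (S n ω)) ∂μ =
      ENNReal.ofReal (Real.exp (-(d * κ * (1 + (excess (b * κ ^ (-p)) p).toReal) * s))) := by
  have h0 : 0 < κ * s := by positivity
  rw [hS.lintegral_ringWeight hd h0.le le_rfl le_rfl (W := κ * s * (excess (b * κ ^ (-p)) p).toReal)
    (by positivity) (measurable_attn_right _ _ _)]
  · congr 2; ring
  · rw [lintegral_attn_mul hb hκ hs, ENNReal.ofReal_mul h0.le,
      ENNReal.ofReal_toReal (excess_ne_top (by positivity) hp)]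

lemma IsLinePPP.lintegral_first_le (hT : IsLinePPP μ c T) (hc : 0 ≤ c)
    (hmono : ∀ᵐ ω ∂μ, Monotone fun n => T n ω) {a p s q : ℝ} (ha : 0 ≤ a) (hp : 1 < p)
    (hs : 0 < s) (hq : 1 < q) :
    ∫⁻ ω, (Ioc s (s * q)).indicator (fun _ => expNeg
        (∑' n, ringWeight s (s * q) (ENNReal.ofReal 0) (attn a p s) (T n ω))) (T 0 ω) ∂μ ≤
      ENNReal.ofReal (c * (s * q - s) *
        Real.exp (-(c * (1 + (excess a p).toReal - (q - 1))) * s)) := by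
  have hst : s ≤ s * q := by nlinarith
  set W : ENNReal := ∫⁻ u in Ioi (s * q), (1 - expNeg (attn a p s u)) with hWdef
  have hs1 : ∫⁻ u in Ioi s, (1 - expNeg (attn a p s u)) =
      ENNReal.ofReal (s * (excess a p).toReal) := by
    rw [lintegral_attn ha hs, ENNReal.ofReal_mul hs.le, ENNReal.ofReal_toReal (excess_ne_top ha hp)]
  have hWle : W ≤ ENNReal.ofReal (s * (excess a p).toReal) := by
    rw [← hs1]; exact lintegral_mono_set (Ioi_subset_Ioi hst)
  have hWfin : W ≠ ⊤ := (hWle.trans_lt ENNReal.ofReal_lt_top).ne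
  -- The thinning integral runs from `s`, but the weight acts only beyond `s * q`. The missing part
  -- is at most the ring length, since `1 - expNeg` is at most one; this is the source of the error
  -- `q - 1` in the exponent.
  have hle : s * (excess a p).toReal ≤ (s * q - s) + W.toReal := by
    have h1 : ENNReal.ofReal (s * (excess a p).toReal) ≤ ENNReal.ofReal (s * q - s) + W := by
      rw [← hs1, ← Ioc_union_Ioi_eq_Ioi hst, lintegral_union measurableSet_Ioi
        (Set.disjoint_left.2 fun u hu hu' => not_lt.2 hu.2 hu')]
      gcongr
      calc ∫⁻ u in Ioc s (s * q), (1 - expNeg (attn a p s u))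
          ≤ ∫⁻ u in Ioc s (s * q), 1 := lintegral_mono fun u => tsub_le_self
        _ = ENNReal.ofReal (s * q - s) := by simp
    rw [← ENNReal.ofReal_toReal hWfin, ← ENNReal.ofReal_add (by linarith) ENNReal.toReal_nonneg]
      at h1
    exact (ENNReal.ofReal_le_ofReal_iff (add_nonneg (by linarith) ENNReal.toReal_nonneg)).1 h1
  rw [hT.lintegral_ringWeight_first hc hmono hs.le hst le_rfl (W := W.toReal)
    ENNReal.toReal_nonneg (measurable_attn_right _ _ _)
    (by rw [ENNReal.ofReal_toReal hWfin])]
  refine ENNReal.ofReal_le_ofReal ?_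
  rw [neg_zero, Real.exp_zero, mul_one]
  have hx : 1 - Real.exp (-(c * (s * q - s))) ≤ c * (s * q - s) := by
    linarith [Real.one_sub_le_exp_neg (c * (s * q - s))]
  have hx0 : 0 ≤ c * (s * q - s) := mul_nonneg hc (by linarith)
  calc Real.exp (-(c * (s * q + W.toReal))) * (Real.exp (c * (s * q - s)) - 1)
      = Real.exp (-(c * (s + W.toReal))) * (1 - Real.exp (-(c * (s * q - s)))) := by
        have h1 : Real.exp (-(c * (s * q + W.toReal))) * Real.exp (c * (s * q - s)) =
            Real.exp (-(c * (s + W.toReal))) := by rw [← Real.exp_add]; congr 1; ring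
        have h2 : Real.exp (-(c * (s + W.toReal))) * Real.exp (-(c * (s * q - s))) =
            Real.exp (-(c * (s * q + W.toReal))) := by rw [← Real.exp_add]; congr 1; ring
        linear_combination h1 + h2
    _ ≤ Real.exp (-(c * (s + W.toReal))) * (c * (s * q - s)) := by gcongr
    _ ≤ Real.exp (-(c * (1 + (excess a p).toReal - (q - 1))) * s) * (c * (s * q - s)) := by
        refine mul_le_mul_of_nonneg_right (Real.exp_le_exp.2 ?_) hx0
        rw [neg_mul, neg_le_neg_iff, mul_assoc]
        refine mul_le_mul_of_nonneg_left ?_ hc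
        nlinarith
    _ = _ := mul_comm _ _

/-- The factor `exp c₀` cancels the weight `c₀` that the first point itself carries. The bound is
then `exp x - 1 ≥ x` with `x = c (t - s) exp (-c₀)`. -/
lemma IsLinePPP.le_lintegral_first (hT : IsLinePPP μ c T) (hc : 0 ≤ c)
    (hmono : ∀ᵐ ω ∂μ, Monotone fun n => T n ω) {a p s t c₀ : ℝ} (ha : 0 ≤ a) (hp : 1 < p)
    (hs : 0 < s) (hst : s ≤ t) (hc₀ : 0 ≤ c₀) :
    ENNReal.ofReal (c * (t - s) * Real.exp (-(c * (1 + (excess a p).toReal)) * t)) ≤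
      ENNReal.ofReal (Real.exp c₀) * ∫⁻ ω, (Ioc s t).indicator (fun _ => expNeg
        (∑' n, ringWeight s t (ENNReal.ofReal c₀) (attn a p t) (T n ω))) (T 0 ω) ∂μ := by
  have ht : 0 < t := hs.trans_le hst
  rw [hT.lintegral_ringWeight_first hc hmono hs.le hst hc₀ (W := t * (excess a p).toReal)
    (by positivity) (measurable_attn_right _ _ _)
    (by rw [lintegral_attn ha ht, ENNReal.ofReal_mul ht.le,
      ENNReal.ofReal_toReal (excess_ne_top ha hp)]), ← ENNReal.ofReal_mul (Real.exp_nonneg _)]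
  refine ENNReal.ofReal_le_ofReal ?_
  have hx := Real.add_one_le_exp (c * (t - s) * Real.exp (-c₀))
  calc c * (t - s) * Real.exp (-(c * (1 + (excess a p).toReal)) * t)
      = Real.exp c₀ * (Real.exp (-(c * (t + t * (excess a p).toReal))) *
          (c * (t - s) * Real.exp (-c₀))) := by
        have h1 : Real.exp c₀ * Real.exp (-c₀) = 1 := by rw [← Real.exp_add]; simp
        have h2 : -(c * (1 + (excess a p).toReal)) * t = -(c * (t + t * (excess a p).toReal)) := by
          ring
        rw [h2]
        linear_combination (-(c * (t - s) * Real.exp (-(c * (t + t * (excess a p).toReal))))) * h1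
    _ ≤ _ := by
        gcongr
        linarith

section Sandwich

variable {a b p κ : ℝ} {E : Set Ω}

/-- Lowering the load raises `expNeg`: the reference distance `T 0` is replaced by `s` and the
weights inside the ring by zero. On `E` all points of `S` lie beyond `κ * s`, so the infinite
weights cost nothing. The bound is a product of a functional of `T` and one of `S`, which are
independent. -/
lemma setLIntegral_load_le [IsProbabilityMeasure μ] (hT : IsLinePPP μ c T) (hS : IsLinePPP μ d S)
    (hc : 0 ≤ c) (hd : 0 ≤ d) (hTm : ∀ᵐ ω ∂μ, Monotone fun n => T n ω)
    (hSm : ∀ᵐ ω ∂μ, Monotone fun n => S n ω)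
    (hind : IndepFun (fun ω n => T n ω) (fun ω n => S n ω) μ) (ha : 0 ≤ a) (hb : 0 ≤ b)
    (hp : 1 < p) (hκ : 0 < κ) (hEm : MeasurableSet E) (hE : ∀ ω ∈ E, κ * T 0 ω ≤ S 0 ω)
    {s q : ℝ} (hs : 0 < s) (hq : 1 < q) :
    ∫⁻ ω in E ∩ T 0 ⁻¹' Ioc s (s * q), expNeg (load a b p T S ω) ∂μ ≤
      ENNReal.ofReal (c * (s * q - s) * Real.exp (-(c * (1 + (excess a p).toReal - (q - 1)) +
        d * κ * (1 + (excess (b * κ ^ (-p)) p).toReal)) * s)) := by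
  have hmE : MeasurableSet (E ∩ T 0 ⁻¹' Ioc s (s * q)) :=
    hEm.inter (hT.measurable 0 measurableSet_Ioc)
  rw [← lintegral_indicator hmE]
  calc ∫⁻ ω, (E ∩ T 0 ⁻¹' Ioc s (s * q)).indicator (fun ω => expNeg (load a b p T S ω)) ω ∂μ
      ≤ ∫⁻ ω, (Ioc s (s * q)).indicator (fun _ => expNeg
          (∑' n, ringWeight s (s * q) (ENNReal.ofReal 0) (attn a p s) (T n ω))) (T 0 ω) *
        expNeg (∑' n, ringWeight (κ * s) (κ * s) (ENNReal.ofReal 0) (attn b p s) (S n ω)) ∂μ := by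
        refine lintegral_mono_ae ?_
        filter_upwards [hTm, hSm] with ω hTω hSω
        by_cases hω : ω ∈ E ∩ T 0 ⁻¹' Ioc s (s * q)
        · have hI : T 0 ω ∈ Ioc s (s * q) := hω.2
          rw [indicator_of_mem hω, indicator_of_mem hI, load, expNeg_add]
          refine mul_le_mul' (expNeg_antitone ?_) (expNeg_antitone ?_)
          · rw [tsum_eq_zero_add' ENNReal.summable]
            have h0 : ringWeight s (s * q) (ENNReal.ofReal 0) (attn a p s) (T 0 ω) = 0 := by
              simp [ringWeight, not_le.2 hI.1, hI.2]
            rw [h0, zero_add]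
            refine ENNReal.tsum_le_tsum fun n => ?_
            have h1 : s < T (n + 1) ω := hI.1.trans_le (hTω (Nat.zero_le _))
            simp only [ringWeight, not_le.2 h1, if_false]
            split_ifs with h2
            · simp
            · exact attn_mono ha (by linarith) hs.le hI.1.le (hs.trans h1).le
          · refine ENNReal.tsum_le_tsum fun n => ?_
            have h1 : κ * s < S n ω := calc
              κ * s < κ * T 0 ω := by gcongr; exact hI.1
              _ ≤ S 0 ω := hE ω hω.1
              _ ≤ S n ω := hSω (Nat.zero_le _)
            simp only [ringWeight, not_le.2 h1, if_false]
            exact attn_mono hb (by linarith) hs.le hI.1.le ((mul_pos hκ hs).trans h1).le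
        · rw [indicator_of_notMem hω]; exact zero_le
    _ ≤ _ := by
        rw [lintegral_first_mul_of_indepFun hT.measurable hS.measurable hind _ _
          (measurable_ringWeight _ _ _ (measurable_attn_right _ _ _))
          (measurable_ringWeight _ _ _ (measurable_attn_right _ _ _)),
          hS.lintegral_cross hd hb hp hκ hs]
        refine (mul_le_mul_left (hT.lintegral_first_le hc hTm ha hp hs hq) _).trans_eq ?_
        have : 0 ≤ s * q - s := by nlinarith
        rw [← ENNReal.ofReal_mul (by positivity), mul_assoc, ← Real.exp_add]
        congr 3; ring

/-- Here the load is raised: `T 0` becomes `t`, and points inside the ring get the maximal weight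
`log (1 + a)`. Forbidding points of `S` up to `κ * t` forces `κ * T 0 < S 0`, hence membership in
`E`. -/
lemma le_setLIntegral_load [IsProbabilityMeasure μ] (hT : IsLinePPP μ c T) (hS : IsLinePPP μ d S)
    (hc : 0 ≤ c) (hd : 0 ≤ d) (hTm : ∀ᵐ ω ∂μ, Monotone fun n => T n ω)
    (hSm : ∀ᵐ ω ∂μ, Monotone fun n => S n ω)
    (hind : IndepFun (fun ω n => T n ω) (fun ω n => S n ω) μ) (ha : 0 ≤ a) (hb : 0 ≤ b)
    (hp : 1 < p) (hκ : 0 < κ) (hEm : MeasurableSet E) (hE : ∀ ω, κ * T 0 ω < S 0 ω → ω ∈ E)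
    {s t : ℝ} (hs : 0 < s) (hst : s ≤ t) :
    ENNReal.ofReal (c * (t - s) * Real.exp (-(c * (1 + (excess a p).toReal) +
        d * κ * (1 + (excess (b * κ ^ (-p)) p).toReal)) * t)) ≤
      ∫⁻ ω in E ∩ T 0 ⁻¹' Ioc s t, expNeg (load a b p T S ω) ∂μ := by
  have ht : 0 < t := hs.trans_le hst
  have hmE : MeasurableSet (E ∩ T 0 ⁻¹' Ioc s t) :=
    hEm.inter (hT.measurable 0 measurableSet_Ioc)
  have hc₀ : 0 ≤ Real.log (1 + a) := Real.log_nonneg (by linarith)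
  set c₀ := Real.log (1 + a) with hc₀def
  rw [← lintegral_indicator hmE]
  calc ENNReal.ofReal (c * (t - s) * Real.exp (-(c * (1 + (excess a p).toReal) +
        d * κ * (1 + (excess (b * κ ^ (-p)) p).toReal)) * t))
      = ENNReal.ofReal (c * (t - s) * Real.exp (-(c * (1 + (excess a p).toReal)) * t)) *
        ENNReal.ofReal (Real.exp (-(d * κ * (1 + (excess (b * κ ^ (-p)) p).toReal) * t))) := by
        have : 0 ≤ t - s := by linarith
        rw [← ENNReal.ofReal_mul (by positivity), mul_assoc (c * (t - s)), ← Real.exp_add]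
        congr 3; ring
    _ ≤ ENNReal.ofReal (Real.exp c₀) * ((∫⁻ ω, (Ioc s t).indicator (fun _ => expNeg
        (∑' n, ringWeight s t (ENNReal.ofReal c₀) (attn a p t) (T n ω))) (T 0 ω) ∂μ) *
        ∫⁻ ω, expNeg (∑' n,
          ringWeight (κ * t) (κ * t) (ENNReal.ofReal 0) (attn b p t) (S n ω)) ∂μ) := by
        rw [← mul_assoc, hS.lintegral_cross hd hb hp hκ ht]
        exact mul_le_mul_left (hT.le_lintegral_first hc hTm ha hp hs hst hc₀) _
    _ = ENNReal.ofReal (Real.exp c₀) * ∫⁻ ω, (Ioc s t).indicator (fun _ => expNeg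
        (∑' n, ringWeight s t (ENNReal.ofReal c₀) (attn a p t) (T n ω))) (T 0 ω) *
        expNeg (∑' n,
          ringWeight (κ * t) (κ * t) (ENNReal.ofReal 0) (attn b p t) (S n ω)) ∂μ := by
        rw [lintegral_first_mul_of_indepFun hT.measurable hS.measurable hind _ _
          (measurable_ringWeight _ _ _ (measurable_attn_right _ _ _))
          (measurable_ringWeight _ _ _ (measurable_attn_right _ _ _))]
    _ = ∫⁻ ω, ENNReal.ofReal (Real.exp c₀) * ((Ioc s t).indicator (fun _ => expNeg
        (∑' n, ringWeight s t (ENNReal.ofReal c₀) (attn a p t) (T n ω))) (T 0 ω) *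
        expNeg (∑' n,
          ringWeight (κ * t) (κ * t) (ENNReal.ofReal 0) (attn b p t) (S n ω))) ∂μ :=
        (lintegral_const_mul' _ _ ENNReal.ofReal_ne_top).symm
    _ ≤ _ := by
        refine lintegral_mono_ae ?_
        filter_upwards [hTm, hSm] with ω hTω hSω
        by_cases hI : T 0 ω ∈ Ioc s t
        swap
        · rw [indicator_of_notMem hI]; simp
        rw [indicator_of_mem hI]
        rcases le_or_gt (S 0 ω) (κ * t) with hS0 | hS0
        · rw [expNeg_tsum_ringWeight_of_le (x := fun n => S n ω) hS0]; simp
        have hωE : ω ∈ E := by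
          refine hE ω (lt_of_le_of_lt ?_ hS0)
          exact mul_le_mul_of_nonneg_left hI.2 hκ.le
        have hT0 : 0 < T 0 ω := hs.trans hI.1
        rw [indicator_of_mem (show ω ∈ E ∩ T 0 ⁻¹' Ioc s t from ⟨hωE, hI⟩), load, expNeg_add,
          ← mul_assoc]
        refine mul_le_mul' ?_ (expNeg_antitone ?_)
        · rw [tsum_eq_zero_add' ENNReal.summable]
          have h0 : ringWeight s t (ENNReal.ofReal c₀) (attn a p t) (T 0 ω) =
              ENNReal.ofReal c₀ := by
            simp [ringWeight, not_le.2 hI.1, hI.2]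
          rw [h0, expNeg_add, expNeg_ofReal hc₀, ← mul_assoc,
            ← ENNReal.ofReal_mul (Real.exp_nonneg _), ← Real.exp_add, add_neg_cancel,
            Real.exp_zero, ENNReal.ofReal_one, one_mul]
          refine expNeg_antitone (ENNReal.tsum_le_tsum fun n => ?_)
          have h1 : T 0 ω ≤ T (n + 1) ω := hTω (Nat.zero_le _)
          simp only [ringWeight, not_le.2 (hI.1.trans_le h1), if_false]
          split_ifs with h2
          · exact attn_le_log ha (by linarith) hT0.le h1
          · exact attn_mono ha (by linarith) hT0.le hI.2 (hT0.le.trans h1)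
        · refine ENNReal.tsum_le_tsum fun n => ?_
          have h1 : κ * t < S n ω := hS0.trans_le (hSω (Nat.zero_le _))
          simp only [ringWeight, not_le.2 h1, if_false]
          exact attn_mono hb (by linarith) hT0.le hI.2 ((mul_pos hκ ht).trans h1).le

/-- The Laplace transform of the interference at the first point of `T`, on the event that this
point is the nearest one in the scaled sense `κ * T 0 ≤ S 0`. -/
theorem setLIntegral_expNeg_load [IsProbabilityMeasure μ] (hT : IsLinePPP μ c T)
    (hS : IsLinePPP μ d S) (hc : 0 < c) (hd : 0 < d) (hTm : ∀ᵐ ω ∂μ, Monotone fun n => T n ω)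
    (hSm : ∀ᵐ ω ∂μ, Monotone fun n => S n ω)
    (hind : IndepFun (fun ω n => T n ω) (fun ω n => S n ω) μ) (ha : 0 ≤ a) (hb : 0 ≤ b)
    (hp : 1 < p) (hκ : 0 < κ) (hEm : MeasurableSet E) (hE₁ : ∀ ω, κ * T 0 ω < S 0 ω → ω ∈ E)
    (hE₂ : ∀ ω ∈ E, κ * T 0 ω ≤ S 0 ω) :
    ∫⁻ ω in E, expNeg (load a b p T S ω) ∂μ =
      ENNReal.ofReal (c / (c * (1 + (excess a p).toReal) +
        d * κ * (1 + (excess (b * κ ^ (-p)) p).toReal))) := by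
  set A := (excess a p).toReal with hA
  set B := (excess (b * κ ^ (-p)) p).toReal with hB
  have hA0 : 0 ≤ A := ENNReal.toReal_nonneg
  have hB0 : 0 ≤ B := ENNReal.toReal_nonneg
  set D := c * (1 + A) + d * κ * (1 + B) with hD
  have hD0 : 0 < D := by positivity
  -- The first point is almost surely positive, so the geometric rings partition `E` up to a null
  -- set.
  have hsplit : ∀ q : ℝ, 1 < q → ∫⁻ ω in E, expNeg (load a b p T S ω) ∂μ =
      ∑' i : ℤ, ∫⁻ ω in E ∩ T 0 ⁻¹' Ioc (q ^ i) (q ^ (i + 1)), expNeg (load a b p T S ω) ∂μ := by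
    intro q hq
    have h1 : E =ᵐ[μ] ⋃ i : ℤ, E ∩ T 0 ⁻¹' Ioc (q ^ i) (q ^ (i + 1)) := by
      filter_upwards [hT.ae_pos] with ω hω
      have h2 : ω ∈ T 0 ⁻¹' ⋃ i : ℤ, Ioc (q ^ i) (q ^ (i + 1)) := by
        rw [iUnion_Ioc_zpow hq]; exact hω 0
      rw [preimage_iUnion] at h2
      refine propext ?_
      change ω ∈ E ↔ ω ∈ ⋃ i : ℤ, E ∩ T 0 ⁻¹' Ioc (q ^ i) (q ^ (i + 1))
      rw [← inter_iUnion]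
      exact ⟨fun h => ⟨h, h2⟩, fun h => h.1⟩
    rw [setLIntegral_congr h1, lintegral_iUnion
      (fun i => hEm.inter (hT.measurable 0 measurableSet_Ioc))]
    intro i j hij
    exact ((pairwise_disjoint_Ioc_zpow_real hq hij).preimage (T 0)).mono inter_subset_right
      inter_subset_right
  have hupper : ∀ q : ℝ, q ∈ Ioo 1 2 → ∫⁻ ω in E, expNeg (load a b p T S ω) ∂μ ≤
      ENNReal.ofReal (c * q / (D - c * (q - 1))) := by
    intro q hq
    -- The restriction `q < 2` serves here: it keeps the perturbed exponent positive.
    have hD' : 0 < D - c * (q - 1) := by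
      have h1 : 0 < c * (2 - q) := mul_pos hc (by linarith [hq.2])
      have h2 : 0 < d * κ * (1 + B) := by positivity
      have h3 : 0 ≤ c * A := by positivity
      rw [hD]; linarith
    rw [hsplit q hq.1]
    refine le_trans (ENNReal.tsum_le_tsum fun i => ?_) (tsum_zpow_exp_le hq.1 hc.le hD')
    have h0 : q ≠ 0 := by linarith [hq.1]
    rw [zpow_add_one₀ h0]
    refine (setLIntegral_load_le hT hS hc.le hd.le hTm hSm hind ha hb hp hκ hEm hE₂
      (zpow_pos (by linarith [hq.1]) i) hq.1).trans_eq ?_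
    congr 3
    rw [hD]; ring
  have hlower : ∀ q : ℝ, q ∈ Ioo 1 2 → ENNReal.ofReal (c / (D * q)) ≤
      ∫⁻ ω in E, expNeg (load a b p T S ω) ∂μ := by
    intro q hq
    rw [hsplit q hq.1]
    refine le_trans (le_tsum_zpow_exp hq.1 hc.le hD0) (ENNReal.tsum_le_tsum fun i => ?_)
    exact le_setLIntegral_load hT hS hc.le hd.le hTm hSm hind ha hb hp hκ hEm hE₁
      (zpow_pos (by linarith [hq.1]) i) (zpow_right_mono₀ hq.1.le (by omega))
  have hmem : ∀ᶠ q in 𝓝[>] (1 : ℝ), q ∈ Ioo 1 2 := Ioo_mem_nhdsGT one_lt_two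
  -- Both bounds tend to `c / D` as `q` decreases to one.
  refine le_antisymm (ge_of_tendsto ?_ (hmem.mono hupper)) (le_of_tendsto ?_ (hmem.mono hlower))
  · have h : ContinuousAt (fun q : ℝ => c * q / (D - c * (q - 1))) 1 :=
      ContinuousAt.div (by fun_prop) (by fun_prop) (by simpa using hD0.ne')
    have h2 := ENNReal.tendsto_ofReal (h.tendsto.mono_left (nhdsWithin_le_nhds (s := Ioi 1)))
    simpa using h2
  · have h : ContinuousAt (fun q : ℝ => c / (D * q)) 1 :=
      ContinuousAt.div (by fun_prop) (by fun_prop) (by simpa using hD0.ne')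
    have h2 := ENNReal.tendsto_ofReal (h.tendsto.mono_left (nhdsWithin_le_nhds (s := Ioi 1)))
    simpa using h2

end Sandwich

end Line

/-! ### The function `rho` -/

/-- Substitute `u = a ^ (-2 / α) * v`. At `a = 0` both integrands vanish, because `0 ^ (2 / α) = 0`.
-/
lemma toReal_excess {a α : ℝ} (ha : 0 ≤ a) (hα : 2 < α) :
    (excess a (α / 2)).toReal = rho a α := by
  have h1 : (excess a (α / 2)).toReal = ∫ v in Ioi (1 : ℝ), a / (a + v ^ (α / 2)) := by
    rw [excess, integral_eq_lintegral_of_nonneg_ae]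
    · refine (ae_restrict_mem measurableSet_Ioi).mono fun v hv => ?_
      have hv0 : (0 : ℝ) < v := one_pos.trans hv
      show (0 : ℝ) ≤ a / (a + v ^ (α / 2))
      positivity
    · exact Measurable.aestronglyMeasurable (by fun_prop)
  rw [h1, rho]
  rcases ha.eq_or_lt with rfl | ha
  · rw [Real.zero_rpow (by positivity : 2 / α ≠ 0)]
    simp
  · set b := a ^ (-2 / α) with hb
    have hb0 : 0 < b := Real.rpow_pos_of_pos ha _
    have hbp : a ^ (2 / α) = b⁻¹ := by
      rw [hb, neg_div, Real.rpow_neg ha.le, inv_inv]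
    have hbα : b ^ (α / 2) = a⁻¹ := by
      rw [hb, ← Real.rpow_mul ha.le, show -2 / α * (α / 2) = -1 by field_simp, Real.rpow_neg_one]
    have h2 := integral_comp_mul_left_Ioi' (fun u => a ^ (2 / α) / (1 + u ^ (α / 2))) 1 hb0
    rw [mul_one] at h2
    rw [← h2, smul_eq_mul, ← integral_const_mul]
    refine setIntegral_congr_fun measurableSet_Ioi fun v hv => ?_
    have hv0 : (0 : ℝ) < v := one_pos.trans hv
    have := Real.rpow_pos_of_pos hv0 (α / 2)
    simp only [hbp]
    rw [Real.mul_rpow hb0.le hv0.le, hbα]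
    field_simp

lemma rho_nonneg {a α : ℝ} (ha : 0 ≤ a) (hα : 2 < α) : 0 ≤ rho a α := by
  rw [← toReal_excess ha hα]; exact ENNReal.toReal_nonneg

lemma rho_le {a α : ℝ} (ha : 0 ≤ a) (hα : 2 < α) : rho a α ≤ a * (1 / (α / 2 - 1)) := by
  have h : (1 : ℝ) < α / 2 := by linarith
  have h' : 0 < α / 2 - 1 := by linarith
  rw [← toReal_excess ha hα]
  exact ENNReal.toReal_le_of_le_ofReal (by positivity) (excess_le ha h)

/-- For `a > 1` the integrand `a / (a + v ^ (α / 2))` is at least `1 / 2` up to `v = a ^ (2 / α)`.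
This growth is what makes the ergodic rate finite. -/
lemma rpow_le_one_add_rho {a α : ℝ} (ha : 0 ≤ a) (hα : 2 < α) :
    a ^ (2 / α) / 2 ≤ 1 + rho a α := by
  have hr := rho_nonneg ha hα
  rcases le_or_gt a 1 with h1 | h1
  · have : a ^ (2 / α) ≤ 1 := Real.rpow_le_one ha h1 (by positivity)
    linarith
  · have hx : 1 ≤ a ^ (2 / α) := Real.one_le_rpow h1.le (by positivity)
    have h2 : ENNReal.ofReal ((a ^ (2 / α) - 1) / 2) ≤ excess a (α / 2) := by
      calc ENNReal.ofReal ((a ^ (2 / α) - 1) / 2)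
          = ∫⁻ v in Ioc (1 : ℝ) (a ^ (2 / α)), ENNReal.ofReal (1 / 2) := by
            rw [setLIntegral_const, Real.volume_Ioc, ← ENNReal.ofReal_mul (by norm_num)]
            congr 1; ring
        _ ≤ ∫⁻ v in Ioc (1 : ℝ) (a ^ (2 / α)), ENNReal.ofReal (a / (a + v ^ (α / 2))) := by
            refine setLIntegral_mono (by fun_prop) fun v hv => ENNReal.ofReal_le_ofReal ?_
            have hv0 : (0 : ℝ) < v := one_pos.trans hv.1
            have h3 : v ^ (α / 2) ≤ a := by
              calc v ^ (α / 2) ≤ (a ^ (2 / α)) ^ (α / 2) :=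
                    Real.rpow_le_rpow hv0.le hv.2 (by positivity)
                _ = a := by
                    rw [← Real.rpow_mul ha, show 2 / α * (α / 2) = 1 by field_simp, Real.rpow_one]
            have := Real.rpow_pos_of_pos hv0 (α / 2)
            rw [div_le_div_iff₀ (by norm_num) (by positivity)]
            linarith
        _ ≤ excess a (α / 2) := lintegral_mono_set Ioc_subset_Ioi_self
    have h3 := ENNReal.toReal_mono (excess_ne_top ha (by linarith : (1 : ℝ) < α / 2)) h2
    rw [toReal_excess ha hα, ENNReal.toReal_ofReal (by linarith)] at h3
    linarith

/-! ### Positivity of the feedback coefficients -/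

/-- For `m = 2 ^ B` and `s = 1 / (NB - 1)`, the quotient of the two sides is `1 - ζ`. In the
induction the left side gains the factor `m + 1`, the right side the larger `m + 1 + s`. -/
lemma Gamma_mul_Gamma_lt {s : ℝ} (hs : 0 < s) (m : ℕ) (hm : 1 ≤ m) :
    Real.Gamma (m + 1) * Real.Gamma (1 + s) < Real.Gamma (m + (1 + s)) := by
  have hG : 0 < Real.Gamma (1 + s) := Real.Gamma_pos_of_pos (by linarith)
  induction m, hm using Nat.le_induction with
  | base =>
    rw [Nat.cast_one, show (1 : ℝ) + (1 + s) = (1 + s) + 1 by ring,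
      Real.Gamma_add_one (show 1 + s ≠ 0 by linarith), Real.Gamma_add_one one_ne_zero,
      Real.Gamma_one]
    nlinarith
  | succ m hm ih =>
    have h1 : (0 : ℝ) < m + (1 + s) := by positivity
    rw [Nat.cast_add_one, Real.Gamma_add_one (show (m : ℝ) + 1 ≠ 0 by positivity),
      show (m : ℝ) + 1 + (1 + s) = (m + (1 + s)) + 1 by ring, Real.Gamma_add_one h1.ne', mul_assoc]
    have h2 : 0 < Real.Gamma ((m : ℝ) + (1 + s)) := Real.Gamma_pos_of_pos h1
    calc ((m : ℝ) + 1) * (Real.Gamma (m + 1) * Real.Gamma (1 + s))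
        < ((m : ℝ) + 1) * Real.Gamma (m + (1 + s)) := by gcongr
      _ ≤ (m + (1 + s)) * Real.Gamma (m + (1 + s)) := by gcongr; linarith

lemma zeta_pos {NB : ℕ} (B : ℕ) (hNB : 2 ≤ NB) : 0 < zeta NB B := by
  have hN : (2 : ℝ) ≤ NB := by exact_mod_cast hNB
  have hs : 0 < 1 / ((NB : ℝ) - 1) := by
    have : (0 : ℝ) < NB - 1 := by linarith
    positivity
  have hc : (NB : ℝ) / (NB - 1) = 1 + 1 / ((NB : ℝ) - 1) := by
    have : (NB : ℝ) - 1 ≠ 0 := by linarith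
    field_simp
    ring
  have h := Gamma_mul_Gamma_lt hs (2 ^ B) Nat.one_le_two_pow
  rw [Nat.cast_pow, Nat.cast_ofNat, Real.Gamma_add_one (by positivity)] at h
  rw [zeta, hc, beta, sub_pos, ← mul_div_assoc, div_lt_one (Real.Gamma_pos_of_pos (by positivity)),
    ← mul_assoc]
  exact h

lemma upsilon_pos (NB B : ℕ) : 0 < upsilon NB B := Real.rpow_pos_of_pos two_pos _

/-! ### Exponential gains -/

lemma lintegral_expMeasure {f : ℝ → ENNReal} (hf : Measurable f) :
    ∫⁻ x, f x ∂(expMeasure 1) = ∫⁻ x in Ioi 0, ENNReal.ofReal (Real.exp (-x)) * f x := by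
  have hm : Measurable (gammaPDF 1 1) := (measurable_gammaPDFReal 1 1).ennreal_ofReal
  rw [expMeasure, gammaMeasure, lintegral_withDensity_eq_lintegral_mul _ hm hf,
    ← setLIntegral_univ, ← Iio_union_Ici (a := (0 : ℝ)), lintegral_union measurableSet_Ici
    (Set.disjoint_left.2 fun u hu hu' => not_le.2 (mem_Iio.1 hu) hu'),
    setLIntegral_congr_fun measurableSet_Iio (g := fun _ => 0), lintegral_zero, zero_add,
    setLIntegral_congr Ioi_ae_eq_Ici.symm]
  · refine setLIntegral_congr_fun measurableSet_Ioi fun x hx => ?_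
    have := exponentialPDF_of_nonneg (r := 1) (le_of_lt (mem_Ioi.1 hx))
    rw [one_mul, one_mul] at this
    rw [Pi.mul_apply, ← this]
    rfl
  · intro x hx
    rw [Pi.mul_apply, gammaPDF_of_neg hx, zero_mul]

lemma expMeasure_Ici {z : ℝ} (hz : 0 ≤ z) :
    expMeasure 1 (Ici z) = ENNReal.ofReal (Real.exp (-z)) := by
  rw [← lintegral_indicator_one measurableSet_Ici,
    lintegral_expMeasure (measurable_one.indicator measurableSet_Ici)]
  have : ∀ x, ENNReal.ofReal (Real.exp (-x)) * (Ici z).indicator (1 : ℝ → ENNReal) x =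
      (Ici z).indicator (fun x => ENNReal.ofReal (Real.exp (-x))) x := by
    intro x
    by_cases hx : x ∈ Ici z <;> simp [hx]
  simp_rw [this]
  rw [setLIntegral_indicator measurableSet_Ici, setLIntegral_congr (t := Ioi z),
    ← ofReal_integral_eq_lintegral_ofReal (integrableOn_exp_neg_Ioi z)
      (ae_of_all _ fun x => Real.exp_nonneg _), integral_exp_neg_Ioi]
  rcases hz.eq_or_lt with rfl | hz
  · rw [inter_eq_right.2 Ioi_subset_Ici_self]; exact Filter.EventuallyEq.rfl
  · rw [inter_eq_left.2 (Ici_subset_Ioi.2 hz)]; exact Ioi_ae_eq_Ici.symm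

lemma expMeasure_Iic_zero : expMeasure 1 (Iic 0) = 0 := by
  rw [← lintegral_indicator_one measurableSet_Iic,
    lintegral_expMeasure (measurable_one.indicator measurableSet_Iic),
    setLIntegral_congr_fun measurableSet_Ioi (g := fun _ => 0), lintegral_zero]
  intro x hx
  have : x ∉ Iic (0 : ℝ) := fun h => not_lt.2 (mem_Iic.1 h) hx
  simp [this]

lemma lintegral_expNeg_expMeasure {c : ℝ} (hc : 0 ≤ c) :
    ∫⁻ x, expNeg (ENNReal.ofReal (c * x)) ∂(expMeasure 1) =
      expNeg (ENNReal.ofReal (Real.log (1 + c))) := by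
  rw [lintegral_expMeasure (f := fun x => expNeg (ENNReal.ofReal (c * x)))
      (measurable_expNeg.comp (by fun_prop)),
    expNeg_ofReal (Real.log_nonneg (by linarith)), Real.exp_neg, Real.exp_log (by linarith)]
  have h := setLIntegral_exp_neg zero_le_one (show 0 < 1 + c by linarith)
  rw [one_div] at h
  rw [← h]
  refine setLIntegral_congr_fun measurableSet_Ioi fun x hx => ?_
  have hx0 : 0 < x := hx
  rw [expNeg_ofReal (by positivity), ← ENNReal.ofReal_mul (Real.exp_nonneg _), ← Real.exp_add,
    one_mul]
  congr 2; ring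

lemma expMeasure_le_ofReal (z : ENNReal) :
    expMeasure 1 {x | z ≤ ENNReal.ofReal x} = expNeg z := by
  have : IsProbabilityMeasure (expMeasure 1) := isProbabilityMeasure_expMeasure one_pos
  induction z with
  | top => simp
  | coe z =>
    -- At `z = 0` truncation by `ENNReal.ofReal` admits negative `x` as well, and the set is the
    -- whole line.
    rcases eq_or_ne z 0 with rfl | hz
    · simp
    · have : {x : ℝ | (z : ENNReal) ≤ ENNReal.ofReal x} = Ici (z : ℝ) := by
        ext x
        rw [mem_ofPred_eq, mem_Ici, ← ENNReal.ofReal_coe_nnreal]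
        exact ENNReal.ofReal_le_ofReal_iff'.trans (or_iff_left fun h => hz (by
          exact_mod_cast le_antisymm h z.coe_nonneg))
      rw [this, expMeasure_Ici z.coe_nonneg, ← ENNReal.ofReal_coe_nnreal (p := z),
        expNeg_ofReal z.coe_nonneg]

section Gains

variable {Ω ι : Type*} [MeasurableSpace Ω] {μ : Measure Ω} {G : ι → Ω → ℝ}

/-- By independence, integrate the tail `exp (-z)` of the gain `G j` against the law of the sum; the
resulting Laplace transform factors over `s`. -/
lemma measure_finsetSum_le_gain (hG : ∀ i, Measurable (G i)) (hlaw : ∀ i, μ.map (G i) = expMeasure 1)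
    (hind : iIndepFun G μ) {c : ι → ℝ} (hc : ∀ i, 0 ≤ c i) {j : ι} {s : Finset ι} (hj : j ∉ s) :
    μ {ω | ∑ i ∈ s, ENNReal.ofReal (c i * G i ω) ≤ ENNReal.ofReal (G j ω)} =
      expNeg (∑ i ∈ s, ENNReal.ofReal (Real.log (1 + c i))) := by
  classical
  have := hind.isProbabilityMeasure
  -- Coefficient one at `j` puts the serving gain and the weighted interferers into one independent
  -- family.
  set f : ι → Ω → ENNReal := fun i ω => ENNReal.ofReal (Function.update c j 1 i * G i ω) with hf
  have hfm : ∀ i, Measurable (f i) := fun i => by have := hG i; fun_prop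
  have hfind : iIndepFun f μ :=
    hind.comp (fun i x => ENNReal.ofReal (Function.update c j 1 i * x)) (fun i => by fun_prop)
  have hfs : ∀ i ∈ s, ∀ ω, f i ω = ENNReal.ofReal (c i * G i ω) := by
    intro i hi ω
    have : i ≠ j := fun h => hj (h ▸ hi)
    simp [hf, this]
  have hfj : ∀ ω, f j ω = ENNReal.ofReal (G j ω) := fun ω => by simp [hf]
  set Z : Ω → ENNReal := ∑ i ∈ s, f i with hZ
  have hZm : Measurable Z := by
    rw [hZ, Finset.sum_fn]; exact Finset.measurable_sum s fun i _ => hfm i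
  have hZapp : ∀ ω, Z ω = ∑ i ∈ s, ENNReal.ofReal (c i * G i ω) := fun ω => by
    rw [hZ, Finset.sum_apply]; exact Finset.sum_congr rfl fun i hi => hfs i hi ω
  have hZind : IndepFun Z (f j) μ := hfind.indepFun_finsetSum_of_notMem hfm hj
  have hle : MeasurableSet {x : ENNReal × ENNReal | x.1 ≤ x.2} :=
    measurableSet_le measurable_fst measurable_snd
  have hset : {ω | ∑ i ∈ s, ENNReal.ofReal (c i * G i ω) ≤ ENNReal.ofReal (G j ω)} =
      (fun ω => (Z ω, f j ω)) ⁻¹' {x | x.1 ≤ x.2} := by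
    ext ω; simp [hZapp, hfj]
  rw [hset, ← Measure.map_apply (hZm.prodMk (hfm j)) hle,
    (indepFun_iff_map_prod_eq_prod_map_map hZm.aemeasurable (hfm j).aemeasurable).1 hZind,
    Measure.prod_apply hle]
  have htail : ∀ z : ENNReal, μ.map (f j) (Prod.mk z ⁻¹' {x | x.1 ≤ x.2}) = expNeg z := by
    intro z
    rw [Measure.map_apply (hfm j) (measurable_prodMk_left hle), ← expMeasure_le_ofReal z,
      ← hlaw j, Measure.map_apply (hG j) (measurableSet_le measurable_const (by fun_prop))]
    congr 1
    ext ω; simp [hfj]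
  simp_rw [htail]
  rw [lintegral_map measurable_expNeg hZm]
  simp_rw [hZ, Finset.sum_apply, expNeg_sum]
  rw [lintegral_prod_eq_prod_lintegral_of_indepFun s (fun i ω => expNeg (f i ω))
    (hfind.comp (fun _ => expNeg) fun _ => measurable_expNeg)
    (fun i => measurable_expNeg.comp (hfm i))]
  refine Finset.prod_congr rfl fun i hi => ?_
  simp_rw [hfs i hi]
  rw [← lintegral_expNeg_expMeasure (hc i), ← hlaw i,
    lintegral_map (f := fun x => expNeg (ENNReal.ofReal (c i * x)))
      (measurable_expNeg.comp (by fun_prop)) (hG i)]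

/-- The probability that an exponential gain exceeds a weighted sum of other, independent
exponential gains. -/
theorem measure_tsum_le_gain [Countable ι] (hG : ∀ i, Measurable (G i))
    (hlaw : ∀ i, μ.map (G i) = expMeasure 1) (hind : iIndepFun G μ) {c : ι → ℝ}
    (hc : ∀ i, 0 ≤ c i) {j : ι} (hj : c j = 0) :
    μ {ω | ∑' i, ENNReal.ofReal (c i * G i ω) ≤ ENNReal.ofReal (G j ω)} =
      expNeg (∑' i, ENNReal.ofReal (Real.log (1 + c i))) := by
  classical
  have := hind.isProbabilityMeasure
  set A : Finset ι → Set Ω :=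
    fun s => {ω | ∑ i ∈ s, ENNReal.ofReal (c i * G i ω) ≤ ENNReal.ofReal (G j ω)} with hA
  have hAm : ∀ s, MeasurableSet (A s) := fun s => measurableSet_le
    (Finset.measurable_sum _ fun i _ => by have := hG i; fun_prop) (by have := hG j; fun_prop)
  have hAμ : ∀ s, μ (A s) = expNeg (∑ i ∈ s, ENNReal.ofReal (Real.log (1 + c i))) := by
    intro s
    have h := measure_finsetSum_le_gain hG hlaw hind hc (Finset.notMem_erase j s)
    rw [Finset.sum_erase _ (by simp [hj])] at h
    rw [← h]
    congr 1
    ext ω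
    simp only [hA, mem_ofPred_eq]
    rw [Finset.sum_erase _ (by simp [hj])]
  -- The events decrease along finite index sets to the event for the full series, so continuity
  -- from above applies.
  have hanti : Antitone A := by
    intro s t hst ω hω
    rw [hA, mem_ofPred_eq] at hω ⊢
    exact (Finset.sum_le_sum_of_subset hst).trans hω
  have hInter : ⋂ s, A s = {ω | ∑' i, ENNReal.ofReal (c i * G i ω) ≤ ENNReal.ofReal (G j ω)} := by
    ext ω
    simp only [hA, mem_iInter, mem_ofPred_eq, ENNReal.tsum_eq_iSup_sum, iSup_le_iff]
  have h1 := tendsto_measure_iInter_atTop (μ := μ) (fun s => (hAm s).nullMeasurableSet) hanti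
    ⟨∅, measure_ne_top _ _⟩
  rw [hInter] at h1
  refine tendsto_nhds_unique h1 ?_
  refine Tendsto.congr (fun s => (hAμ s).symm) ?_
  exact (continuous_expNeg.tendsto _).comp ENNReal.summable.hasSum

end Gains

/-! ### Averaging over gains and positions -/

section Network

lemma div_sq_rpow {r u : ℝ} (hr : 0 ≤ r) (hu : 0 ≤ u) (α : ℝ) :
    (r ^ 2 / u ^ 2) ^ (α / 2) = r ^ α * u ^ (-α) := by
  rw [← div_pow, ← Real.rpow_natCast, ← Real.rpow_mul (by positivity), Real.div_rpow hr hu,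
    Real.rpow_neg hu, div_eq_mul_inv]
  norm_num
  rw [mul_div_cancel₀ α two_ne_zero]

/-- A measurable set of configurations comparing the nearest points of the two tiers, with the
squared distances scaled by `κ`; ties may be broken either way. -/
structure IsAssocRegion (κ : ℝ) (E : Set ((ℕ → Plane) × (ℕ → Plane))) : Prop where
  measurableSet : MeasurableSet E
  mem_of_lt : ∀ x, κ * ‖x.1 0‖ ^ 2 < ‖x.2 0‖ ^ 2 → x ∈ E
  le_of_mem : ∀ x ∈ E, κ * ‖x.1 0‖ ^ 2 ≤ ‖x.2 0‖ ^ 2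

/-- Interference at the first point of `x`, relative to the path loss of that point. -/
def interf (a b p : ℝ) (x y : ℕ → Plane) (g h : ℕ → ℝ) : ENNReal :=
  ∑' n, ENNReal.ofReal (a * (‖x 0‖ ^ 2 / ‖x (n + 1)‖ ^ 2) ^ p * g (n + 1)) +
    ∑' n, ENNReal.ofReal (b * (‖x 0‖ ^ 2 / ‖y n‖ ^ 2) ^ p * h n)

lemma measurable_interf (a b p : ℝ) :
    Measurable fun z : ((ℕ → Plane) × (ℕ → Plane)) × ((ℕ → ℝ) × (ℕ → ℝ)) =>
      interf a b p z.1.1 z.1.2 z.2.1 z.2.2 := by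
  unfold interf
  refine Measurable.add (Measurable.tsum fun n => ?_) (Measurable.tsum fun n => ?_) <;> fun_prop

variable {Ω : Type*} [MeasurableSpace Ω] {μ : Measure Ω}
  {lamF lamR : ℝ} {X Y : ℕ → Ω → Plane} {g h : ℕ → Ω → ℝ}

/-- Exchanging the two tiers. -/
lemma IsNetwork.symm (hnet : IsNetwork μ lamF lamR X Y g h) : IsNetwork μ lamR lamF Y X h g where
  pppF := hnet.pppR
  pppR := hnet.pppF
  sortedF := hnet.sortedR
  sortedR := hnet.sortedF
  measurable_g := hnet.measurable_h
  measurable_h := hnet.measurable_g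
  exp_g := hnet.exp_h
  exp_h := hnet.exp_g
  indep_tiers := hnet.indep_tiers.symm
  indep_gains := by
    have h1 := hnet.indep_gains.precomp (g := Sum.swap) Sum.swap_leftInverse.injective
    convert h1 using 2 with i
    cases i <;> rfl
  indep_positions_gains := hnet.indep_positions_gains.comp measurable_swap measurable_swap

/-- The positions of both tiers. -/
abbrev positions (X Y : ℕ → Ω → Plane) (ω : Ω) : (ℕ → Plane) × (ℕ → Plane) :=
  ((fun n => X n ω), (fun n => Y n ω))

lemma IsNetwork.measurable_positions (hnet : IsNetwork μ lamF lamR X Y g h) :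
    Measurable (positions X Y) :=
  (measurable_pi_lambda _ hnet.pppF.measurable).prodMk
    (measurable_pi_lambda _ hnet.pppR.measurable)

lemma IsNetwork.measure_gains (hnet : IsNetwork μ lamF lamR X Y g h) {c d : ℕ → ℝ}
    (hc : ∀ n, 0 ≤ c n) (hd : ∀ n, 0 ≤ d n) :
    μ {ω | ∑' n, ENNReal.ofReal (c n * g (n + 1) ω) + ∑' n, ENNReal.ofReal (d n * h n ω) ≤
        ENNReal.ofReal (g 0 ω)} =
      expNeg (∑' n, ENNReal.ofReal (Real.log (1 + c n)) +
        ∑' n, ENNReal.ofReal (Real.log (1 + d n))) := by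
  -- Coefficient zero at `Sum.inl 0` excludes the serving link from the interference.
  set e : ℕ ⊕ ℕ → ℝ := Sum.elim (fun n => Nat.casesOn n 0 c) d with he
  have h1 := measure_tsum_le_gain (G := Sum.elim g h) (c := e) (j := Sum.inl 0)
    (by rintro (i | i); exacts [hnet.measurable_g i, hnet.measurable_h i])
    (by rintro (i | i); exacts [hnet.exp_g i, hnet.exp_h i]) hnet.indep_gains
    (by rintro ((_ | _) | _); exacts [le_refl (0 : ℝ), hc _, hd _]) rfl
  have hsplit : ∀ f : ℕ ⊕ ℕ → ENNReal, f (Sum.inl 0) = 0 →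
      ∑' i, f i = ∑' n, f (Sum.inl (n + 1)) + ∑' n, f (Sum.inr n) := by
    intro f hf
    rw [Summable.tsum_sum ENNReal.summable ENNReal.summable]
    rw [tsum_eq_zero_add' (f := fun n => f (Sum.inl n)) ENNReal.summable, hf, zero_add]
  rw [hsplit _ (by simp [he])] at h1
  rw [show (∑' n, ENNReal.ofReal (Real.log (1 + c n)) + ∑' n, ENNReal.ofReal (Real.log (1 + d n))) =
    ∑' n, ENNReal.ofReal (Real.log (1 + e (Sum.inl (n + 1)))) +
      ∑' n, ENNReal.ofReal (Real.log (1 + e (Sum.inr n))) from rfl, ← h1]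
  congr 1
  ext ω
  rw [mem_ofPred_eq, mem_ofPred_eq, hsplit _ (by simp [he])]
  rfl

variable [IsProbabilityMeasure μ]

/-- Positions and gains are independent, so their joint law is a product. For fixed positions, the
section over the gains has the probability given by `measure_gains`. -/
lemma IsNetwork.measure_inter_interf (hnet : IsNetwork μ lamF lamR X Y g h) {a b p : ℝ}
    (ha : 0 ≤ a) (hb : 0 ≤ b) {E : Set ((ℕ → Plane) × (ℕ → Plane))} (hE : MeasurableSet E) :
    μ (positions X Y ⁻¹' E ∩
        {ω | interf a b p (fun n => X n ω) (fun n => Y n ω) (fun n => g n ω) (fun n => h n ω) ≤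
          ENNReal.ofReal (g 0 ω)}) =
      ∫⁻ ω in positions X Y ⁻¹' E,
        expNeg (load a b p (fun n ω => ‖X n ω‖ ^ 2) (fun n ω => ‖Y n ω‖ ^ 2) ω) ∂μ := by
  set pos := positions X Y with hpos
  set gain : Ω → (ℕ → ℝ) × (ℕ → ℝ) := fun ω => ((fun n => g n ω), (fun n => h n ω)) with hgain
  have hposm : Measurable pos := hnet.measurable_positions
  have hgainm : Measurable gain := (measurable_pi_lambda _ hnet.measurable_g).prodMk
    (measurable_pi_lambda _ hnet.measurable_h)
  set M : Set (((ℕ → Plane) × (ℕ → Plane)) × ((ℕ → ℝ) × (ℕ → ℝ))) :=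
    Prod.fst ⁻¹' E ∩ {z | interf a b p z.1.1 z.1.2 z.2.1 z.2.2 ≤ ENNReal.ofReal (z.2.1 0)} with hM
  have hMm : MeasurableSet M := (measurable_fst hE).inter
    (measurableSet_le (measurable_interf a b p) (by fun_prop))
  have hset : pos ⁻¹' E ∩ {ω | interf a b p (fun n => X n ω) (fun n => Y n ω) (fun n => g n ω)
      (fun n => h n ω) ≤ ENNReal.ofReal (g 0 ω)} = (fun ω => (pos ω, gain ω)) ⁻¹' M := rfl
  set L : (ℕ → Plane) × (ℕ → Plane) → ENNReal := fun x =>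
    expNeg (∑' n, attn a p (‖x.1 0‖ ^ 2) (‖x.1 (n + 1)‖ ^ 2) +
      ∑' n, attn b p (‖x.1 0‖ ^ 2) (‖x.2 n‖ ^ 2)) with hL
  have hLm : Measurable L := by
    refine measurable_expNeg.comp (Measurable.add (Measurable.tsum fun n => ?_)
      (Measurable.tsum fun n => ?_)) <;> unfold attn <;> fun_prop
  have hsec : ∀ x, μ.map gain (Prod.mk x ⁻¹' M) = E.indicator L x := by
    intro x
    by_cases hx : x ∈ E
    · rw [indicator_of_mem hx, Measure.map_apply hgainm (measurable_prodMk_left hMm)]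
      have h1 := hnet.measure_gains
        (c := fun n => a * (‖x.1 0‖ ^ 2 / ‖x.1 (n + 1)‖ ^ 2) ^ p)
        (d := fun n => b * (‖x.1 0‖ ^ 2 / ‖x.2 n‖ ^ 2) ^ p)
        (fun n => by positivity) (fun n => by positivity)
      refine Eq.trans (congrArg μ ?_) h1
      ext ω
      exact ⟨fun h => h.2, fun h => ⟨hx, h⟩⟩
    · rw [indicator_of_notMem hx]
      have : Prod.mk x ⁻¹' M = ∅ := by
        ext z; exact iff_of_false (fun h => hx h.1) (fun h => h)
      rw [this, measure_empty]
  rw [hset, ← Measure.map_apply (hposm.prodMk hgainm) hMm,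
    (indepFun_iff_map_prod_eq_prod_map_map hposm.aemeasurable hgainm.aemeasurable).1
      hnet.indep_positions_gains, Measure.prod_apply hMm]
  simp_rw [hsec]
  rw [lintegral_indicator hE, setLIntegral_map hE hLm hposm]
  rfl

/-- The probability that the serving gain of the first point of `X` exceeds the weighted
interference, jointly with an association event `E`. -/
theorem IsNetwork.measure_inter_interf_eq (hnet : IsNetwork μ lamF lamR X Y g h)
    (hF : 0 < lamF) (hR : 0 < lamR) {a b κ α : ℝ} (hα : 2 < α)
    (ha : 0 ≤ a) (hb : 0 ≤ b) (hκ : 0 < κ) {E : Set ((ℕ → Plane) × (ℕ → Plane))}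
    (hE : IsAssocRegion κ E) :
    μ (positions X Y ⁻¹' E ∩
        {ω | interf a b (α / 2) (fun n => X n ω) (fun n => Y n ω) (fun n => g n ω)
          (fun n => h n ω) ≤ ENNReal.ofReal (g 0 ω)}) =
      ENNReal.ofReal (lamF / (lamF * (1 + rho a α) +
        lamR * κ * (1 + rho (b * κ ^ (-(α / 2))) α))) := by
  have hsq : ∀ {x : ℕ → ℝ}, (∀ n, 0 ≤ x n) → Monotone x → Monotone fun n => x n ^ 2 :=
    fun hx hm i j hij => pow_le_pow_left₀ (hx i) (hm hij) 2
  have hm : Measurable fun x : ℕ → Plane => fun n => ‖x n‖ ^ 2 := by fun_prop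
  have hposm := hnet.measurable_positions
  have hTm : ∀ᵐ ω ∂μ, Monotone fun n => ‖X n ω‖ ^ 2 :=
    hnet.sortedF.mono fun ω hω => hsq (fun _ => norm_nonneg _) hω
  have hSm : ∀ᵐ ω ∂μ, Monotone fun n => ‖Y n ω‖ ^ 2 :=
    hnet.sortedR.mono fun ω hω => hsq (fun _ => norm_nonneg _) hω
  have hind : IndepFun (fun ω n => ‖X n ω‖ ^ 2) (fun ω n => ‖Y n ω‖ ^ 2) μ :=
    hnet.indep_tiers.comp hm hm
  have hp : 1 < α / 2 := by linarith
  have key := setLIntegral_expNeg_load (hnet.pppF.isLinePPP hF.le) (hnet.pppR.isLinePPP hR.le)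
    (mul_pos hF Real.pi_pos) (mul_pos hR Real.pi_pos) hTm hSm hind ha hb hp hκ (hposm hE.measurableSet)
    (fun ω hω => hE.mem_of_lt ((fun n => X n ω), (fun n => Y n ω)) hω)
    (fun ω hω => hE.le_of_mem ((fun n => X n ω), (fun n => Y n ω)) hω)
  rw [hnet.measure_inter_interf ha hb hE.measurableSet, key, toReal_excess ha hα,
    toReal_excess (by positivity) hα]
  have h1 := rho_nonneg ha hα
  have h2 := rho_nonneg (show 0 ≤ b * κ ^ (-(α / 2)) by positivity) hα
  generalize rho a α = A at h1
  generalize rho (b * κ ^ (-(α / 2))) α = B at h2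
  rw [show lamF * Real.pi * (1 + A) + lamR * Real.pi * κ * (1 + B) =
    (lamF * (1 + A) + lamR * κ * (1 + B)) * Real.pi by ring,
    mul_div_mul_right _ _ Real.pi_pos.ne']

lemma IsNetwork.ae_pos (hnet : IsNetwork μ lamF lamR X Y g h) (hF : 0 < lamF) (hR : 0 < lamR) :
    ∀ᵐ ω ∂μ, (∀ n, 0 < ‖X n ω‖) ∧ (∀ n, 0 < ‖Y n ω‖) ∧ (∀ n, 0 < g n ω) ∧ ∀ n, 0 < h n ω := by
  have hgain : ∀ {G : Ω → ℝ}, Measurable G → μ.map G = expMeasure 1 → ∀ᵐ ω ∂μ, 0 < G ω := by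
    intro G hG hlaw
    have h1 := expMeasure_Iic_zero
    rw [← hlaw, Measure.map_apply hG measurableSet_Iic] at h1
    rw [ae_iff]
    exact measure_mono_null (fun ω hω => not_lt.1 hω) h1
  filter_upwards [(hnet.pppF.isLinePPP hF.le).ae_pos, (hnet.pppR.isLinePPP hR.le).ae_pos,
    ae_all_iff.2 fun n => hgain (hnet.measurable_g n) (hnet.exp_g n),
    ae_all_iff.2 fun n => hgain (hnet.measurable_h n) (hnet.exp_h n)] with ω h1 h2 h3 h4
  refine ⟨fun n => ?_, fun n => ?_, h3, h4⟩
  · exact (norm_nonneg _).lt_of_ne fun h => by simpa [← h] using h1 n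
  · exact (norm_nonneg _).lt_of_ne fun h => by simpa [← h] using h2 n

end Network

/-! ### Mean rate as an integral of coverage -/

section LayerCake

variable {Ω : Type*} [MeasurableSpace Ω] {ν : Measure Ω} {γ : Ω → ℝ}

lemma le_logb_one_add_iff {t x : ℝ} (hx : 0 ≤ x) :
    t ≤ Real.logb 2 (1 + x) ↔ 2 ^ t - 1 ≤ x := by
  rw [Real.le_logb_iff_rpow_le one_lt_two (by linarith)]
  constructor <;> intro h <;> linarith

lemma logb_one_add_nonneg {x : ℝ} (hx : 0 ≤ x) : 0 ≤ Real.logb 2 (1 + x) :=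
  Real.logb_nonneg one_lt_two (by linarith)

lemma measurable_logb_one_add (hγ : Measurable γ) :
    Measurable fun ω => Real.logb 2 (1 + γ ω) := by
  unfold Real.logb
  exact (Real.measurable_log.comp (measurable_const.add hγ)).div_const _

/-- No integrability is assumed, so this form can be used to establish it. -/
lemma lintegral_logb_one_add (hγ : Measurable γ) (hγ0 : 0 ≤ᵐ[ν] γ) :
    ∫⁻ ω, ENNReal.ofReal (Real.logb 2 (1 + γ ω)) ∂ν =
      ∫⁻ t in Ioi (0 : ℝ), ν {ω | 2 ^ t - 1 ≤ γ ω} := by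
  rw [lintegral_eq_lintegral_meas_le ν (hγ0.mono fun ω hω => logb_one_add_nonneg hω)
    (measurable_logb_one_add hγ).aemeasurable]
  refine setLIntegral_congr_fun measurableSet_Ioi fun t _ => measure_congr ?_
  filter_upwards [hγ0] with ω hω
  exact propext (le_logb_one_add_iff hω)

/-- The mean rate is the integral of the coverage probabilities. -/
lemma integral_logb_one_add [IsFiniteMeasure ν] (hγ : Measurable γ) (hγ0 : 0 ≤ᵐ[ν] γ)
    (hint : Integrable (fun ω => Real.logb 2 (1 + γ ω)) ν) :
    IntegrableOn (fun t : ℝ => ν.real {ω | 2 ^ t - 1 ≤ γ ω}) (Ioi 0) ∧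
      ∫ ω, Real.logb 2 (1 + γ ω) ∂ν = ∫ t in Ioi (0 : ℝ), ν.real {ω | 2 ^ t - 1 ≤ γ ω} := by
  have hlog0 : 0 ≤ᵐ[ν] fun ω => Real.logb 2 (1 + γ ω) :=
    hγ0.mono fun ω hω => logb_one_add_nonneg hω
  constructor
  · have hanti : Antitone fun t : ℝ => ν.real {ω | 2 ^ t - 1 ≤ γ ω} := by
      intro s t hst
      refine measureReal_mono fun ω hω => ?_
      rw [mem_ofPred_eq] at hω ⊢
      have := Real.rpow_le_rpow_of_exponent_le one_le_two hst
      linarith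
    refine ⟨hanti.measurable.aestronglyMeasurable, ?_⟩
    have h1 := hint.lintegral_lt_top
    rw [lintegral_logb_one_add hγ hγ0] at h1
    refine lt_of_le_of_lt (lintegral_mono fun t => ?_) h1
    rw [Real.enorm_of_nonneg measureReal_nonneg, ofReal_measureReal]
  · rw [hint.integral_eq_integral_meas_le hlog0]
    refine setIntegral_congr_fun measurableSet_Ioi fun t _ => measureReal_congr ?_
    filter_upwards [hγ0] with ω hω
    exact propext (le_logb_one_add_iff hω)

end LayerCake

/-! ### A user served by the first point of one tier -/

section Tagged

variable {Ω : Type*}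

/-- Interference plus noise at a user served by the first point of `X`, with interference powers
`A` and `B` of the two tiers. -/
def tagNoise (A B σ2 α : ℝ) (X Y : ℕ → Ω → Plane) (g h : ℕ → Ω → ℝ) (ω : Ω) : ℝ :=
  A * (∑' n, g (n + 1) ω * ‖X (n + 1) ω‖ ^ (-α)) + B * (∑' n, h n ω * ‖Y n ω‖ ^ (-α)) + σ2

/-- SINR of a user served with power `P` by the first point of `X`. -/
def tagSinr (P A B σ2 α : ℝ) (X Y : ℕ → Ω → Plane) (g h : ℕ → Ω → ℝ) (ω : Ω) : ℝ :=
  P * g 0 ω * ‖X 0 ω‖ ^ (-α) / tagNoise A B σ2 α X Y g h ω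

/-- Positive distances and gains, and convergent interference. -/
structure IsRegular (α : ℝ) (X Y : ℕ → Ω → Plane) (g h : ℕ → Ω → ℝ) (ω : Ω) : Prop where
  pos_X : ∀ n, 0 < ‖X n ω‖
  pos_Y : ∀ n, 0 < ‖Y n ω‖
  pos_g : ∀ n, 0 < g n ω
  pos_h : ∀ n, 0 < h n ω
  summable_X : Summable fun n => g n ω * ‖X n ω‖ ^ (-α)
  summable_Y : Summable fun n => h n ω * ‖Y n ω‖ ^ (-α)

variable {P A B σ2 α δ : ℝ} {X Y : ℕ → Ω → Plane} {g h : ℕ → Ω → ℝ} {ω : Ω}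

lemma IsRegular.symm (hω : IsRegular α X Y g h ω) : IsRegular α Y X h g ω :=
  ⟨hω.pos_Y, hω.pos_X, hω.pos_h, hω.pos_g, hω.summable_Y, hω.summable_X⟩

lemma IsRegular.tagNoise_pos (hω : IsRegular α X Y g h ω) (hA : 0 ≤ A) (hB : 0 < B)
    (hσ : 0 ≤ σ2) : 0 < tagNoise A B σ2 α X Y g h ω := by
  have h1 : 0 ≤ ∑' n, g (n + 1) ω * ‖X (n + 1) ω‖ ^ (-α) :=
    tsum_nonneg fun n => mul_nonneg (hω.pos_g _).le (Real.rpow_nonneg (norm_nonneg _) _)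
  have h2 : 0 < ∑' n, h n ω * ‖Y n ω‖ ^ (-α) :=
    hω.summable_Y.tsum_pos
      (fun n => mul_nonneg (hω.pos_h _).le (Real.rpow_nonneg (norm_nonneg _) _)) 0
      (mul_pos (hω.pos_h 0) (Real.rpow_pos_of_pos (hω.pos_Y 0) _))
  unfold tagNoise
  have := mul_nonneg hA h1
  have := mul_pos hB h2
  linarith

lemma IsRegular.tagSinr_nonneg (hω : IsRegular α X Y g h ω) (hP : 0 ≤ P) (hA : 0 ≤ A)
    (hB : 0 < B) (hσ : 0 ≤ σ2) : 0 ≤ tagSinr P A B σ2 α X Y g h ω :=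
  div_nonneg (mul_nonneg (mul_nonneg hP (hω.pos_g 0).le) (Real.rpow_nonneg (norm_nonneg _) _))
    (hω.tagNoise_pos hA hB hσ).le

lemma IsRegular.tagSinr_le (hω : IsRegular α X Y g h ω) (hP : 0 ≤ P) (hA : 0 ≤ A)
    (hB : 0 < B) (hσ : 0 ≤ σ2) :
    tagSinr P A B σ2 α X Y g h ω ≤ tagSinr P A B 0 α X Y g h ω := by
  unfold tagSinr
  refine div_le_div_of_nonneg_left (mul_nonneg (mul_nonneg hP (hω.pos_g 0).le)
    (Real.rpow_nonneg (norm_nonneg _) _)) (hω.tagNoise_pos hA hB le_rfl) ?_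
  unfold tagNoise
  linarith

lemma interf_eq {a b : ℝ} (ha : 0 ≤ a) (hb : 0 ≤ b) :
    interf a b (α / 2) (fun n => X n ω) (fun n => Y n ω) (fun n => g n ω) (fun n => h n ω) =
      ENNReal.ofReal (a * ‖X 0 ω‖ ^ α) *
          ∑' n, ENNReal.ofReal (g (n + 1) ω * ‖X (n + 1) ω‖ ^ (-α)) +
        ENNReal.ofReal (b * ‖X 0 ω‖ ^ α) * ∑' n, ENNReal.ofReal (h n ω * ‖Y n ω‖ ^ (-α)) := by
  unfold interf
  rw [← ENNReal.tsum_mul_left, ← ENNReal.tsum_mul_left]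
  congr 1 <;> refine tsum_congr fun n => ?_
  all_goals
    rw [div_sq_rpow (norm_nonneg _) (norm_nonneg _), ← ENNReal.ofReal_mul (by positivity)]
    congr 1
    ring

/-- Multiply by the positive denominator and divide by `P * ‖X 0 ω‖ ^ (-α)`. Summability is needed
to pass between real and extended sums. -/
lemma IsRegular.le_tagSinr_iff (hω : IsRegular α X Y g h ω) (hP : 0 < P) (hA : 0 ≤ A)
    (hB : 0 < B) (hδ : 0 ≤ δ) :
    δ ≤ tagSinr P A B 0 α X Y g h ω ↔
      interf (δ * A / P) (δ * B / P) (α / 2) (fun n => X n ω) (fun n => Y n ω) (fun n => g n ω)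
        (fun n => h n ω) ≤ ENNReal.ofReal (g 0 ω) := by
  have h1 : ∀ n, 0 ≤ g (n + 1) ω * ‖X (n + 1) ω‖ ^ (-α) :=
    fun n => mul_nonneg (hω.pos_g _).le (Real.rpow_nonneg (norm_nonneg _) _)
  have h2 : ∀ n, 0 ≤ h n ω * ‖Y n ω‖ ^ (-α) :=
    fun n => mul_nonneg (hω.pos_h _).le (Real.rpow_nonneg (norm_nonneg _) _)
  have hs := (summable_nat_add_iff 1).2 hω.summable_X
  have hN := hω.tagNoise_pos (σ2 := 0) hA hB le_rfl
  have hX : 0 < ‖X 0 ω‖ ^ α := Real.rpow_pos_of_pos (hω.pos_X 0) _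
  rw [interf_eq (by positivity) (by positivity), ← ENNReal.ofReal_tsum_of_nonneg h1 hs,
    ← ENNReal.ofReal_tsum_of_nonneg h2 hω.summable_Y, ← ENNReal.ofReal_mul (by positivity),
    ← ENNReal.ofReal_mul (by positivity), ← ENNReal.ofReal_add
      (mul_nonneg (by positivity) (tsum_nonneg h1)) (mul_nonneg (by positivity) (tsum_nonneg h2)),
    ENNReal.ofReal_le_ofReal_iff (hω.pos_g 0).le, tagSinr, le_div_iff₀ hN, tagNoise,
    Real.rpow_neg (norm_nonneg _), ← div_eq_mul_inv, le_div_iff₀ hX]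
  generalize ∑' n, g (n + 1) ω * ‖X (n + 1) ω‖ ^ (-α) = S
  generalize ∑' n, h n ω * ‖Y n ω‖ ^ (-α) = R
  rw [add_zero, show δ * A / P * ‖X 0 ω‖ ^ α * S + δ * B / P * ‖X 0 ω‖ ^ α * R =
    δ * (A * S + B * R) * ‖X 0 ω‖ ^ α / P by ring, div_le_iff₀' hP]

variable [MeasurableSpace Ω] {μ : Measure Ω} {lamF lamR κ : ℝ}
  {E : Set ((ℕ → Plane) × (ℕ → Plane))}

lemma measurable_tagSinr (hX : ∀ n, Measurable (X n)) (hY : ∀ n, Measurable (Y n))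
    (hg : ∀ n, Measurable (g n)) (hh : ∀ n, Measurable (h n)) :
    Measurable (tagSinr P A B σ2 α X Y g h) := by
  have h1 : ∀ n, Measurable fun ω => g n ω * ‖X n ω‖ ^ (-α) := fun n =>
    (hg n).mul ((hX n).norm.pow_const _)
  have h2 : ∀ n, Measurable fun ω => h n ω * ‖Y n ω‖ ^ (-α) := fun n =>
    (hh n).mul ((hY n).norm.pow_const _)
  have hS₁ : Measurable fun ω => ∑' n, g (n + 1) ω * ‖X (n + 1) ω‖ ^ (-α) :=
    Measurable.tsum fun n => h1 (n + 1)
  have hS₂ : Measurable fun ω => ∑' n, h n ω * ‖Y n ω‖ ^ (-α) := Measurable.tsum h2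
  have h3 : Measurable (tagNoise A B σ2 α X Y g h) :=
    ((hS₁.const_mul A).add (hS₂.const_mul B)).add_const σ2
  exact (((hg 0).const_mul P).mul ((hX 0).norm.pow_const _)).div h3

variable [IsProbabilityMeasure μ]

/-- With `a = b = 0` there is no interference and the gain condition always holds. The exponent `4`
is an arbitrary admissible choice. -/
lemma IsNetwork.measure_assoc (hnet : IsNetwork μ lamF lamR X Y g h) (hF : 0 < lamF)
    (hR : 0 < lamR) (hκ : 0 < κ) (hE : IsAssocRegion κ E) :
    μ (positions X Y ⁻¹' E) = ENNReal.ofReal (lamF / (lamF + lamR * κ)) := by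
  have h1 := hnet.measure_inter_interf_eq hF hR (α := 4) (by norm_num) le_rfl le_rfl hκ hE
  have h2 : rho 0 4 = 0 :=
    le_antisymm ((rho_le le_rfl (by norm_num)).trans_eq (zero_mul _)) (rho_nonneg le_rfl (by norm_num))
  rw [zero_mul, h2, add_zero, mul_one, mul_one] at h1
  rw [← h1]
  congr 1
  refine (inter_eq_left.2 fun ω _ => ?_).symm
  simp [interf]

/-- For each `a > 0`, the event `interf a a ≤ g 0` forces both interference sums to be finite. As `a
→ 0` its probability within `E` tends to that of `E`, so the sums are finite almost surely on `E`.
-/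
lemma IsNetwork.ae_isRegular_of_mem (hnet : IsNetwork μ lamF lamR X Y g h) (hF : 0 < lamF)
    (hR : 0 < lamR) (hκ : 0 < κ) (hα : 2 < α) (hE : IsAssocRegion κ E) :
    ∀ᵐ ω ∂μ, ω ∈ positions X Y ⁻¹' E → IsRegular α X Y g h ω := by
  set G : Set Ω := {ω | ∑' n, ENNReal.ofReal (g (n + 1) ω * ‖X (n + 1) ω‖ ^ (-α)) < ⊤ ∧
    ∑' n, ENNReal.ofReal (h n ω * ‖Y n ω‖ ^ (-α)) < ⊤} with hG
  have hGm : MeasurableSet G := by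
    have h1 : Measurable fun ω => ∑' n, ENNReal.ofReal (g (n + 1) ω * ‖X (n + 1) ω‖ ^ (-α)) :=
      Measurable.tsum fun n =>
        ((hnet.measurable_g _).mul ((hnet.pppF.measurable _).norm.pow_const _)).ennreal_ofReal
    have h2 : Measurable fun ω => ∑' n, ENNReal.ofReal (h n ω * ‖Y n ω‖ ^ (-α)) :=
      Measurable.tsum fun n =>
        ((hnet.measurable_h _).mul ((hnet.pppR.measurable _).norm.pow_const _)).ennreal_ofReal
    exact (measurableSet_lt h1 measurable_const).inter (measurableSet_lt h2 measurable_const)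
  have hpos := hnet.ae_pos hF hR
  have hle : ∀ a : ℝ, a ∈ Ioi 0 → ENNReal.ofReal (lamF / (lamF * (1 + rho a α) +
      lamR * κ * (1 + rho (a * κ ^ (-(α / 2))) α))) ≤ μ (positions X Y ⁻¹' E ∩ G) := by
    intro a ha
    have ha0 : 0 < a := ha
    rw [← hnet.measure_inter_interf_eq hF hR hα ha0.le ha0.le hκ hE]
    refine measure_mono_ae ?_
    filter_upwards [hpos] with ω hω hωE
    refine ⟨hωE.1, ?_⟩
    have h1 : interf a a (α / 2) (fun n => X n ω) (fun n => Y n ω) (fun n => g n ω)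
      (fun n => h n ω) < ⊤ := lt_of_le_of_lt hωE.2 ENNReal.ofReal_lt_top
    have h2 : ENNReal.ofReal (a * ‖X 0 ω‖ ^ α) ≠ 0 := by
      have := Real.rpow_pos_of_pos (hω.1 0) α
      exact (ENNReal.ofReal_pos.2 (by positivity)).ne'
    rw [interf_eq ha0.le ha0.le, ENNReal.add_lt_top] at h1
    exact ⟨ENNReal.lt_top_of_mul_ne_top_right h1.1.ne h2,
      ENNReal.lt_top_of_mul_ne_top_right h1.2.ne h2⟩
  have hrho : Tendsto (fun a => rho a α) (𝓝[>] 0) (𝓝 0) := by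
    refine squeeze_zero' (g := fun a : ℝ => a * (1 / (α / 2 - 1)))
      (eventually_mem_nhdsWithin.mono fun a ha => rho_nonneg (le_of_lt ha) hα)
      (eventually_mem_nhdsWithin.mono fun a ha => rho_le (le_of_lt ha) hα) ?_
    have : ContinuousAt (fun a : ℝ => a * (1 / (α / 2 - 1))) 0 := by fun_prop
    simpa using this.tendsto.mono_left (nhdsWithin_le_nhds (s := Ioi 0))
  have hrho' : Tendsto (fun a => rho (a * κ ^ (-(α / 2))) α) (𝓝[>] 0) (𝓝 0) := by
    have hk := Real.rpow_pos_of_pos hκ (-(α / 2))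
    refine hrho.comp (tendsto_nhdsWithin_iff.2 ⟨?_, eventually_mem_nhdsWithin.mono fun a ha =>
      mul_pos ha hk⟩)
    have : ContinuousAt (fun a : ℝ => a * κ ^ (-(α / 2))) 0 := by fun_prop
    simpa using this.tendsto.mono_left (nhdsWithin_le_nhds (s := Ioi 0))
  have hlim : Tendsto (fun a => ENNReal.ofReal (lamF / (lamF * (1 + rho a α) +
      lamR * κ * (1 + rho (a * κ ^ (-(α / 2))) α)))) (𝓝[>] 0)
      (𝓝 (ENNReal.ofReal (lamF / (lamF * (1 + 0) + lamR * κ * (1 + 0))))) := by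
    refine ENNReal.tendsto_ofReal (Tendsto.div tendsto_const_nhds
      (((hrho.const_add 1).const_mul lamF).add ((hrho'.const_add 1).const_mul (lamR * κ))) ?_)
    positivity
  have hge : μ (positions X Y ⁻¹' E) ≤ μ (positions X Y ⁻¹' E ∩ G) := by
    rw [hnet.measure_assoc hF hR hκ hE]
    have := le_of_tendsto hlim (eventually_mem_nhdsWithin.mono hle)
    simpa using this
  have hEm : MeasurableSet (positions X Y ⁻¹' E) := hnet.measurable_positions hE.measurableSet
  have heq := ae_eq_of_subset_of_measure_ge inter_subset_left hge
    (hEm.inter hGm).nullMeasurableSet (measure_ne_top μ _)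
  filter_upwards [hpos, heq.mem_iff] with ω hω hiff hωE
  have hωG : ω ∈ G := (hiff.2 hωE).2
  obtain ⟨h1, h2, h3, h4⟩ := hω
  have hs : ∀ f : ℕ → ℝ, (∀ n, 0 ≤ f n) → ∑' n, ENNReal.ofReal (f n) < ⊤ → Summable f :=
    fun f hf hlt => (ENNReal.summable_toReal hlt.ne).congr fun n => ENNReal.toReal_ofReal (hf n)
  refine ⟨h1, h2, h3, h4, (summable_nat_add_iff 1).1 (hs _ (fun n => ?_) hωG.1),
    hs _ (fun n => ?_) hωG.2⟩
  · exact mul_nonneg (h3 _).le (Real.rpow_nonneg (norm_nonneg _) _)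
  · exact mul_nonneg (h4 _).le (Real.rpow_nonneg (norm_nonneg _) _)

lemma IsNetwork.measure_le_tagSinr (hnet : IsNetwork μ lamF lamR X Y g h) (hF : 0 < lamF)
    (hR : 0 < lamR) (hκ : 0 < κ) (hα : 2 < α) (hE : IsAssocRegion κ E) (hP : 0 < P) (hA : 0 < A)
    (hB : 0 < B) (hδ : 0 ≤ δ) :
    μ (positions X Y ⁻¹' E ∩ {ω | δ ≤ tagSinr P A B 0 α X Y g h ω}) =
      ENNReal.ofReal (lamF / (lamF * (1 + rho (δ * A / P) α) +
        lamR * κ * (1 + rho (δ * B / P * κ ^ (-(α / 2))) α))) := by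
  rw [← hnet.measure_inter_interf_eq hF hR hα (by positivity) (by positivity) hκ hE]
  refine measure_congr ?_
  filter_upwards [hnet.ae_isRegular_of_mem hF hR hκ hα hE] with ω hω
  exact propext (and_congr_right fun h => (hω h).le_tagSinr_iff hP hA.le hB hδ)

/-- For `t ≤ 1` coverage is at most one and the exponentials on the right multiply to at least one.
For `t > 1` use `2 ^ t - 1 ≥ 2 ^ (t - 1)` and the growth of `rho`. The prefactor is the sum of the
two constants. -/
lemma coverage_le_exp (hα : 2 < α) (hF : 0 < lamF) (hR : 0 < lamR) (hκ : 0 < κ)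
    {a b t : ℝ} (ha : 0 < a) (hb : 0 ≤ b) (ht : 0 < t) :
    lamF / (lamF * (1 + rho ((2 ^ t - 1) * a) α) + lamR * κ * (1 + rho ((2 ^ t - 1) * b) α)) ≤
      (1 + 2 * a ^ (-(2 / α))) * Real.exp (2 / α * Real.log 2) *
        Real.exp (-(2 / α * Real.log 2) * t) := by
  have hδ : (0 : ℝ) < 2 ^ t - 1 := sub_pos.2 (Real.one_lt_rpow one_lt_two ht)
  have hρ1 := rho_nonneg (show 0 ≤ (2 ^ t - 1) * a by positivity) hα
  have hρ2 := rho_nonneg (show 0 ≤ (2 ^ t - 1) * b by positivity) hα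
  have hρ3 := rpow_le_one_add_rho (show 0 ≤ (2 ^ t - 1) * a by positivity) hα
  have hl : 0 < Real.log 2 := Real.log_pos one_lt_two
  have hc : 0 < 2 / α * Real.log 2 := by positivity
  have hle1 : lamF / (lamF * (1 + rho ((2 ^ t - 1) * a) α) +
      lamR * κ * (1 + rho ((2 ^ t - 1) * b) α)) ≤ (1 + rho ((2 ^ t - 1) * a) α)⁻¹ := by
    have h0 : 0 < 1 + rho ((2 ^ t - 1) * a) α := by linarith
    rw [div_le_iff₀ (by positivity), inv_mul_eq_div, le_div_iff₀ h0]
    have : 0 ≤ lamR * κ * (1 + rho ((2 ^ t - 1) * b) α) := by positivity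
    linarith
  refine hle1.trans ?_
  rw [mul_assoc, ← Real.exp_add]
  rcases le_or_gt t 1 with h1 | h1
  · have h2 : (1 + rho ((2 ^ t - 1) * a) α)⁻¹ ≤ 1 := inv_le_one_of_one_le₀ (by linarith)
    have h3 : 1 ≤ Real.exp (2 / α * Real.log 2 + -(2 / α * Real.log 2) * t) := by
      rw [Real.one_le_exp_iff]; nlinarith
    have h4 : 0 ≤ 2 * a ^ (-(2 / α)) := by positivity
    nlinarith
  · have h2 : (2 : ℝ) ^ (t - 1) ≤ 2 ^ t - 1 := by
      have h3 : (1 : ℝ) ≤ 2 ^ (t - 1) := Real.one_le_rpow one_le_two (by linarith)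
      have h4 : (2 : ℝ) ^ t = 2 ^ (t - 1) * 2 := by
        rw [← Real.rpow_add_one two_ne_zero]; congr 1; ring
      linarith
    have h3 : (2 ^ (t - 1) * a) ^ (2 / α) / 2 ≤ 1 + rho ((2 ^ t - 1) * a) α := by
      refine le_trans ?_ hρ3
      gcongr
    have h4 : 0 < (2 ^ (t - 1) * a) ^ (2 / α) / 2 := by positivity
    refine (inv_anti₀ h4 h3).trans ?_
    have h5 : ((2 ^ (t - 1) * a) ^ (2 / α) / 2)⁻¹ =
        2 * a ^ (-(2 / α)) * Real.exp (2 / α * Real.log 2 + -(2 / α * Real.log 2) * t) := by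
      rw [Real.mul_rpow (by positivity) ha.le, ← Real.rpow_mul zero_le_two,
        Real.rpow_def_of_pos two_pos, Real.rpow_neg ha.le, inv_div,
        show 2 / α * Real.log 2 + -(2 / α * Real.log 2) * t =
          -(Real.log 2 * ((t - 1) * (2 / α))) by ring, Real.exp_neg]
      field_simp
    rw [h5]
    gcongr
    linarith

/-- The rate of a user served by the first point of `X` is integrable. -/
lemma IsNetwork.integrableOn_logb_tagSinr (hnet : IsNetwork μ lamF lamR X Y g h) (hF : 0 < lamF)
    (hR : 0 < lamR) (hκ : 0 < κ) (hα : 2 < α) (hE : IsAssocRegion κ E) (hP : 0 < P) (hA : 0 < A)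
    (hB : 0 < B) (hσ : 0 ≤ σ2) :
    IntegrableOn (fun ω => Real.logb 2 (1 + tagSinr P A B σ2 α X Y g h ω))
      (positions X Y ⁻¹' E) μ := by
  have hEm : MeasurableSet (positions X Y ⁻¹' E) := hnet.measurable_positions hE.measurableSet
  have hm : ∀ σ2, Measurable (tagSinr P A B σ2 α X Y g h) := fun σ2 =>
    measurable_tagSinr hnet.pppF.measurable hnet.pppR.measurable hnet.measurable_g
      hnet.measurable_h
  have hreg : ∀ᵐ ω ∂μ.restrict (positions X Y ⁻¹' E), IsRegular α X Y g h ω :=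
    (ae_restrict_iff' hEm).2 (hnet.ae_isRegular_of_mem hF hR hκ hα hE)
  have hl : 0 < Real.log 2 := Real.log_pos one_lt_two
  refine ⟨(measurable_logb_one_add (hm σ2)).aestronglyMeasurable, ?_⟩
  -- Dropping the noise only raises the SINR and makes the closed form available.
  calc ∫⁻ ω in positions X Y ⁻¹' E, ‖Real.logb 2 (1 + tagSinr P A B σ2 α X Y g h ω)‖ₑ ∂μ
      ≤ ∫⁻ ω in positions X Y ⁻¹' E,
          ENNReal.ofReal (Real.logb 2 (1 + tagSinr P A B 0 α X Y g h ω)) ∂μ := by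
        refine lintegral_mono_ae (hreg.mono fun ω hω => ?_)
        have h1 := hω.tagSinr_nonneg hP.le hA.le hB hσ
        rw [Real.enorm_of_nonneg (logb_one_add_nonneg h1)]
        refine ENNReal.ofReal_le_ofReal (Real.logb_le_logb_of_le one_lt_two (by linarith) ?_)
        linarith [hω.tagSinr_le hP.le hA.le hB hσ]
    _ = ∫⁻ t in Ioi (0 : ℝ), μ.restrict (positions X Y ⁻¹' E)
          {ω | 2 ^ t - 1 ≤ tagSinr P A B 0 α X Y g h ω} :=
        lintegral_logb_one_add (hm 0)
          (hreg.mono fun ω hω => hω.tagSinr_nonneg hP.le hA.le hB le_rfl)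
    _ ≤ ∫⁻ t in Ioi (0 : ℝ), ENNReal.ofReal ((1 + 2 * (A / P) ^ (-(2 / α))) *
          Real.exp (2 / α * Real.log 2) * Real.exp (-(2 / α * Real.log 2) * t)) := by
        refine setLIntegral_mono (by fun_prop) fun t ht => ?_
        have hδ : (0 : ℝ) ≤ 2 ^ t - 1 :=
          sub_nonneg.2 (Real.one_le_rpow one_le_two (le_of_lt ht))
        rw [Measure.restrict_apply' hEm, inter_comm,
          hnet.measure_le_tagSinr hF hR hκ hα hE hP hA hB hδ]
        refine ENNReal.ofReal_le_ofReal ?_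
        have h1 := coverage_le_exp hα hF hR hκ (show 0 < A / P by positivity)
          (show 0 ≤ B / P * κ ^ (-(α / 2)) by positivity) ht
        rwa [← mul_div_assoc, ← mul_assoc, ← mul_div_assoc] at h1
    _ < ⊤ := by
        rw [setLIntegral_exp_neg (by positivity) (by positivity)]
        exact ENNReal.ofReal_lt_top

end Tagged

/-! ### Conditional expectations given the association -/

section Conditioning

variable {Ω : Type*} [MeasurableSpace Ω] {μ : Measure Ω} {E : Set Ω}

lemma ae_cond_of_ae_restrict {p : Ω → Prop} (h : ∀ᵐ ω ∂μ.restrict E, p ω) :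
    ∀ᵐ ω ∂(cond μ E), p ω := Measure.ae_smul_measure h _

lemma integrable_cond {f : Ω → ℝ} (hE : μ E ≠ 0) (hf : IntegrableOn f E μ) :
    Integrable f (cond μ E) := hf.smul_measure (ENNReal.inv_ne_top.2 hE)

lemma setIntegral_eq_mul_integral_cond [IsFiniteMeasure μ] (hE : μ E ≠ 0) (f : Ω → ℝ) :
    ∫ ω in E, f ω ∂μ = μ.real E * ∫ ω, f ω ∂(cond μ E) := by
  have h : μ.real E ≠ 0 := (measureReal_ne_zero_iff (measure_ne_top μ E)).2 hE
  rw [ProbabilityTheory.cond, integral_smul_measure, ENNReal.toReal_inv, smul_eq_mul, ← Measure.real, ← mul_assoc,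
    mul_inv_cancel₀ h, one_mul]

end Conditioning

/-! ### The two association events and the two tiers -/

lemma isAssocRegion_le {k : ℝ} (hk : 0 < k) :
    IsAssocRegion (k ^ 2) {x | k * ‖x.1 0‖ ≤ ‖x.2 0‖} where
  measurableSet := measurableSet_le (by fun_prop) (by fun_prop)
  mem_of_lt x hx := by
    rw [← mul_pow] at hx
    exact (lt_of_pow_lt_pow_left₀ 2 (norm_nonneg _) hx).le
  le_of_mem x hx := by
    rw [← mul_pow]
    exact pow_le_pow_left₀ (by positivity) hx 2

/-- The RRH event seen with the tiers exchanged: `κ` is inverted and ties now go to the other tier.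
-/
lemma isAssocRegion_lt {k : ℝ} (hk : 0 < k) :
    IsAssocRegion (k ^ 2)⁻¹ {x | k * ‖x.2 0‖ ≤ ‖x.1 0‖}ᶜ where
  measurableSet := (measurableSet_le (by fun_prop) (by fun_prop)).compl
  mem_of_lt x hx := by
    rw [inv_mul_lt_iff₀ (by positivity), ← mul_pow] at hx
    exact not_le.2 (lt_of_pow_lt_pow_left₀ 2 (by positivity) hx)
  le_of_mem x hx := by
    rw [inv_mul_le_iff₀ (by positivity), ← mul_pow]
    have h : ¬ k * ‖x.2 0‖ ≤ ‖x.1 0‖ := hx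
    exact pow_le_pow_left₀ (norm_nonneg _) (not_le.1 h).le 2

section Tiers

variable {Ω : Type*} {PF PR α σ2 k : ℝ} {NB B : ℕ} {X Y : ℕ → Ω → Plane} {g h : ℕ → Ω → ℝ}

lemma noiseF_eq : noiseF PF PR α σ2 X Y g h = tagNoise PF PR σ2 α X Y g h := by
  ext ω
  simp only [noiseF, tagNoise, mul_assoc, tsum_mul_left]

lemma noiseR_eq : noiseR PF PR α σ2 NB B X Y g h =
    tagNoise (upsilon NB B * PR) PF σ2 α Y X h g := by
  ext ω
  simp only [noiseR, tagNoise, mul_assoc, tsum_mul_left]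
  ring

lemma sinrF_eq : sinrF PF PR α σ2 X Y g h = tagSinr PF PF PR σ2 α X Y g h := by
  ext ω
  rw [sinrF, tagSinr, noiseF_eq]

lemma sinrR_eq : sinrR PF PR α σ2 NB B X Y g h =
    tagSinr (PR * zeta NB B) (upsilon NB B * PR) PF σ2 α Y X h g := by
  ext ω
  rw [sinrR, tagSinr, noiseR_eq]

lemma assocF_eq : assocF X Y k = positions X Y ⁻¹' {x | k * ‖x.1 0‖ ≤ ‖x.2 0‖} := rfl

lemma assocF_compl_eq :
    (assocF X Y k)ᶜ = positions Y X ⁻¹' {x | k * ‖x.2 0‖ ≤ ‖x.1 0‖}ᶜ := rfl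

variable [MeasurableSpace Ω] {μ : Measure Ω} [IsProbabilityMeasure μ] {lamF lamR : ℝ}

lemma IsNetwork.measure_assocF (hnet : IsNetwork μ lamF lamR X Y g h) (hF : 0 < lamF)
    (hR : 0 < lamR) (hk : 0 < k) : μ (assocF X Y k) = ENNReal.ofReal (probF lamF lamR k) := by
  rw [assocF_eq, hnet.measure_assoc hF hR (by positivity) (isAssocRegion_le hk), probF,
    mul_comm lamR]

lemma IsNetwork.measure_assocF_compl (hnet : IsNetwork μ lamF lamR X Y g h) (hF : 0 < lamF)
    (hR : 0 < lamR) (hk : 0 < k) : μ (assocF X Y k)ᶜ = ENNReal.ofReal (probR lamF lamR k) := by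
  rw [assocF_compl_eq, hnet.symm.measure_assoc hR hF (by positivity) (isAssocRegion_lt hk), probR]
  congr 1
  field_simp
  ring

/-- Regularity does not involve the bias `k`; the partition by `k = 1` covers the whole space. -/
lemma IsNetwork.ae_isRegular (hnet : IsNetwork μ lamF lamR X Y g h) (hF : 0 < lamF)
    (hR : 0 < lamR) (hα : 2 < α) : ∀ᵐ ω ∂μ, IsRegular α X Y g h ω := by
  filter_upwards [hnet.ae_isRegular_of_mem hF hR (by norm_num) hα (isAssocRegion_le one_pos),
    hnet.symm.ae_isRegular_of_mem hR hF (by norm_num) hα (isAssocRegion_lt one_pos)] with ω h1 h2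
  by_cases hω : ω ∈ assocF X Y 1
  · exact h1 hω
  · exact (h2 hω).symm

lemma IsNetwork.successF_eq_closedF (hnet : IsNetwork μ lamF lamR X Y g h) (hF : 0 < lamF)
    (hR : 0 < lamR) (hPF : 0 < PF) (hPR : 0 < PR) (hk : 0 < k) (hα : 2 < α) {δ : ℝ}
    (hδ : 0 ≤ δ) :
    successF PF PR α 0 X Y g h μ k δ = closedF lamF lamR PF PR k δ α := by
  have hE := isAssocRegion_le hk
  have h1 := hnet.measure_le_tagSinr hF hR (by positivity) hα hE hPF hPF hPR hδ
  have hm : MeasurableSet (assocF X Y k) := hnet.measurable_positions hE.measurableSet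
  have harg : δ * PR / PF * (k ^ 2) ^ (-(α / 2)) = δ * PR / (k ^ α * PF) := by
    rw [← Real.rpow_natCast k 2, ← Real.rpow_mul hk.le,
      show ((2 : ℕ) : ℝ) * -(α / 2) = -α by push_cast; ring, Real.rpow_neg hk.le]
    field_simp
  have hr1 := rho_nonneg hδ hα
  have hr2 := rho_nonneg (show 0 ≤ δ * PR / (k ^ α * PF) by positivity) hα
  rw [mul_div_cancel_right₀ _ hPF.ne', harg] at h1
  rw [successF, sinrF_eq, Measure.real, cond_apply hm, hnet.measure_assocF hF hR hk, assocF_eq, h1,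
    ENNReal.toReal_mul, ENNReal.toReal_inv, ENNReal.toReal_ofReal (by unfold probF; positivity),
    ENNReal.toReal_ofReal (by positivity), probF, closedF, inv_div]
  field_simp

lemma IsNetwork.successR_eq_closedR (hnet : IsNetwork μ lamF lamR X Y g h) (hF : 0 < lamF)
    (hR : 0 < lamR) (hPF : 0 < PF) (hPR : 0 < PR) (hk : 0 < k) (hα : 2 < α) (hNB : 2 ≤ NB)
    {δ : ℝ} (hδ : 0 ≤ δ) :
    successR PF PR α 0 NB B X Y g h μ k δ = closedR lamF lamR PF PR k NB B δ α := by
  have hE := isAssocRegion_lt hk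
  have hζ := zeta_pos B hNB
  have hυ := upsilon_pos NB B
  have h1 := hnet.symm.measure_le_tagSinr hR hF (by positivity) hα hE
    (show 0 < PR * zeta NB B by positivity) (show 0 < upsilon NB B * PR by positivity) hPF hδ
  have hm : MeasurableSet (assocF X Y k)ᶜ := hnet.symm.measurable_positions hE.measurableSet
  have harg : δ * PF / (PR * zeta NB B) * ((k ^ 2)⁻¹) ^ (-(α / 2)) =
      δ * k ^ α * PF / (zeta NB B * PR) := by
    rw [Real.inv_rpow (by positivity), ← Real.rpow_neg (by positivity), neg_neg,
      ← Real.rpow_natCast k 2, ← Real.rpow_mul hk.le,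
      show ((2 : ℕ) : ℝ) * (α / 2) = α by push_cast; ring]
    field_simp
  have harg2 : δ * (upsilon NB B * PR) / (PR * zeta NB B) = upsilon NB B * δ / zeta NB B := by
    field_simp
  have hr1 := rho_nonneg (show 0 ≤ δ * k ^ α * PF / (zeta NB B * PR) by positivity) hα
  have hr2 := rho_nonneg (show 0 ≤ upsilon NB B * δ / zeta NB B by positivity) hα
  rw [harg, harg2] at h1
  rw [successR, sinrR_eq, Measure.real, cond_apply hm, hnet.measure_assocF_compl hF hR hk,
    assocF_compl_eq, h1,
    ENNReal.toReal_mul, ENNReal.toReal_inv, ENNReal.toReal_ofReal (by unfold probR; positivity),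
    ENNReal.toReal_ofReal (by positivity), probR, closedR, inv_div]
  field_simp
  ring

end Tiers

end FRAN

end

/-! ### The average ergodic rate -/

theorem corollary2 {Ω : Type*} [MeasurableSpace Ω] (μ : Measure Ω) [IsProbabilityMeasure μ]
    (lamF lamR PF PR α k σ2 : ℝ) (NB B : ℕ)
    (hlamF : 0 < lamF) (hlamR : 0 < lamR) (hPF : 0 < PF) (hPR : 0 < PR)
    (hα : 2 < α) (hk : 0 < k) (hσ2 : 0 ≤ σ2) (hNB : 2 ≤ NB)
    (X Y : ℕ → Ω → FRAN.Plane) (g h : ℕ → Ω → ℝ)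
    (hnet : FRAN.IsNetwork μ lamF lamR X Y g h) :
    -- the interference series converge and the SINRs have positive denominators
    (∀ᵐ ω ∂μ, Summable (fun n => g n ω * ‖X n ω‖ ^ (-α)) ∧
      Summable (fun n => h n ω * ‖Y n ω‖ ^ (-α)) ∧
      0 < FRAN.noiseF PF PR α σ2 X Y g h ω ∧ 0 < FRAN.noiseR PF PR α σ2 NB B X Y g h ω) ∧
    -- the weights are the association probabilities
    μ.real (FRAN.assocF X Y k) = FRAN.probF lamF lamR k ∧
    μ.real (FRAN.assocF X Y k)ᶜ = FRAN.probR lamF lamR k ∧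
    -- the average ergodic rate is finite and is the weighted average of the conditional rates
    Integrable (fun ω => Real.logb 2 (1 + FRAN.sinr PF PR α σ2 NB B X Y g h k ω)) μ ∧
    ∫ ω, Real.logb 2 (1 + FRAN.sinr PF PR α σ2 NB B X Y g h k ω) ∂μ =
      FRAN.probF lamF lamR k *
          (∫ ω, Real.logb 2 (1 + FRAN.sinrF PF PR α σ2 X Y g h ω)
            ∂(cond μ (FRAN.assocF X Y k))) +
        FRAN.probR lamF lamR k *
          (∫ ω, Real.logb 2 (1 + FRAN.sinrR PF PR α σ2 NB B X Y g h ω)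
            ∂(cond μ (FRAN.assocF X Y k)ᶜ)) ∧
    -- each conditional rate is the integral of the success delivery probability
    IntegrableOn (fun t : ℝ => FRAN.successF PF PR α σ2 X Y g h μ k (2 ^ t - 1)) (Ioi 0) ∧
    IntegrableOn (fun t : ℝ => FRAN.successR PF PR α σ2 NB B X Y g h μ k (2 ^ t - 1)) (Ioi 0) ∧
    ∫ ω, Real.logb 2 (1 + FRAN.sinrF PF PR α σ2 X Y g h ω) ∂(cond μ (FRAN.assocF X Y k)) =
      ∫ t in Ioi (0 : ℝ), FRAN.successF PF PR α σ2 X Y g h μ k (2 ^ t - 1) ∧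
    ∫ ω, Real.logb 2 (1 + FRAN.sinrR PF PR α σ2 NB B X Y g h ω) ∂(cond μ (FRAN.assocF X Y k)ᶜ) =
      ∫ t in Ioi (0 : ℝ), FRAN.successR PF PR α σ2 NB B X Y g h μ k (2 ^ t - 1) ∧
    ∫ ω, Real.logb 2 (1 + FRAN.sinr PF PR α σ2 NB B X Y g h k ω) ∂μ =
      FRAN.probF lamF lamR k *
          (∫ t in Ioi (0 : ℝ), FRAN.successF PF PR α σ2 X Y g h μ k (2 ^ t - 1)) +
        FRAN.probR lamF lamR k *
          (∫ t in Ioi (0 : ℝ), FRAN.successR PF PR α σ2 NB B X Y g h μ k (2 ^ t - 1)) ∧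
    -- the interference-limited case, in closed form
    (σ2 = 0 →
      (∀ δ : ℝ, 0 ≤ δ →
        FRAN.successF PF PR α σ2 X Y g h μ k δ = FRAN.closedF lamF lamR PF PR k δ α ∧
        FRAN.successR PF PR α σ2 NB B X Y g h μ k δ =
          FRAN.closedR lamF lamR PF PR k NB B δ α) ∧
      ∫ ω, Real.logb 2 (1 + FRAN.sinr PF PR α σ2 NB B X Y g h k ω) ∂μ =
        FRAN.probF lamF lamR k *
            (∫ t in Ioi (0 : ℝ), FRAN.closedF lamF lamR PF PR k (2 ^ t - 1) α) +
          FRAN.probR lamF lamR k *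
            (∫ t in Ioi (0 : ℝ), FRAN.closedR lamF lamR PF PR k NB B (2 ^ t - 1) α)) := by
  have hregP := hnet.ae_isRegular hlamF hlamR hα
  have hEF := FRAN.isAssocRegion_le hk
  have hER := FRAN.isAssocRegion_lt hk
  have hζ := FRAN.zeta_pos B hNB
  have hυ := FRAN.upsilon_pos NB B
  have hPRζ : 0 < PR * FRAN.zeta NB B := mul_pos hPR hζ
  have hυPR : 0 < FRAN.upsilon NB B * PR := mul_pos hυ hPR
  have hmF : MeasurableSet (FRAN.assocF X Y k) :=
    hnet.measurable_positions hEF.measurableSet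
  have hpF0 : 0 < FRAN.probF lamF lamR k := by unfold FRAN.probF; positivity
  have hpR0 : 0 < FRAN.probR lamF lamR k := by unfold FRAN.probR; positivity
  have hμF := hnet.measure_assocF hlamF hlamR hk
  have hμR := hnet.measure_assocF_compl hlamF hlamR hk
  have hrF : μ.real (FRAN.assocF X Y k) = FRAN.probF lamF lamR k := by
    rw [Measure.real, hμF, ENNReal.toReal_ofReal hpF0.le]
  have hrR : μ.real (FRAN.assocF X Y k)ᶜ = FRAN.probR lamF lamR k := by
    rw [Measure.real, hμR, ENNReal.toReal_ofReal hpR0.le]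
  have hμF0 : μ (FRAN.assocF X Y k) ≠ 0 := by rw [hμF]; exact (ENNReal.ofReal_pos.2 hpF0).ne'
  have hμR0 : μ (FRAN.assocF X Y k)ᶜ ≠ 0 := by rw [hμR]; exact (ENNReal.ofReal_pos.2 hpR0).ne'
  have hmsF : Measurable (FRAN.sinrF PF PR α σ2 X Y g h) := by
    rw [FRAN.sinrF_eq]
    exact FRAN.measurable_tagSinr hnet.pppF.measurable hnet.pppR.measurable hnet.measurable_g
      hnet.measurable_h
  have hmsR : Measurable (FRAN.sinrR PF PR α σ2 NB B X Y g h) := by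
    rw [FRAN.sinrR_eq]
    exact FRAN.measurable_tagSinr hnet.pppR.measurable hnet.pppF.measurable hnet.measurable_h
      hnet.measurable_g
  have hintF : IntegrableOn (fun ω => Real.logb 2 (1 + FRAN.sinrF PF PR α σ2 X Y g h ω))
      (FRAN.assocF X Y k) μ := by
    rw [FRAN.sinrF_eq]
    exact hnet.integrableOn_logb_tagSinr hlamF hlamR (by positivity) hα hEF hPF hPF hPR hσ2
  have hintR : IntegrableOn (fun ω => Real.logb 2 (1 + FRAN.sinrR PF PR α σ2 NB B X Y g h ω))
      (FRAN.assocF X Y k)ᶜ μ := by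
    rw [FRAN.sinrR_eq]
    exact hnet.symm.integrableOn_logb_tagSinr hlamR hlamF (by positivity) hα hER hPRζ hυPR hPF hσ2
  have hposF : ∀ᵐ ω ∂μ, 0 ≤ FRAN.sinrF PF PR α σ2 X Y g h ω := hregP.mono fun ω hω => by
    rw [FRAN.sinrF_eq]; exact hω.tagSinr_nonneg hPF.le hPF.le hPR hσ2
  have hposR : ∀ᵐ ω ∂μ, 0 ≤ FRAN.sinrR PF PR α σ2 NB B X Y g h ω := hregP.mono fun ω hω => by
    rw [FRAN.sinrR_eq]; exact hω.symm.tagSinr_nonneg hPRζ.le hυPR.le hPF hσ2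
  have : IsProbabilityMeasure (cond μ (FRAN.assocF X Y k)) := cond_isProbabilityMeasure hμF0
  have : IsProbabilityMeasure (cond μ (FRAN.assocF X Y k)ᶜ) := cond_isProbabilityMeasure hμR0
  -- The layer-cake formula is applied under the conditional measure, where coverage is `successF`
  -- by definition.
  obtain ⟨hSF, hrateF⟩ := FRAN.integral_logb_one_add hmsF
    (FRAN.ae_cond_of_ae_restrict (ae_restrict_of_ae hposF)) (FRAN.integrable_cond hμF0 hintF)
  obtain ⟨hSR, hrateR⟩ := FRAN.integral_logb_one_add hmsR
    (FRAN.ae_cond_of_ae_restrict (ae_restrict_of_ae hposR)) (FRAN.integrable_cond hμR0 hintR)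
  have heqF : EqOn (fun ω => Real.logb 2 (1 + FRAN.sinr PF PR α σ2 NB B X Y g h k ω))
      (fun ω => Real.logb 2 (1 + FRAN.sinrF PF PR α σ2 X Y g h ω)) (FRAN.assocF X Y k) :=
    fun ω hω => by simp only [FRAN.sinr, if_pos hω]
  have heqR : EqOn (fun ω => Real.logb 2 (1 + FRAN.sinr PF PR α σ2 NB B X Y g h k ω))
      (fun ω => Real.logb 2 (1 + FRAN.sinrR PF PR α σ2 NB B X Y g h ω)) (FRAN.assocF X Y k)ᶜ :=
    fun ω hω => by simp only [FRAN.sinr, if_neg hω]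
  have hint : Integrable (fun ω => Real.logb 2 (1 + FRAN.sinr PF PR α σ2 NB B X Y g h k ω)) μ := by
    rw [← integrableOn_univ, ← union_compl_self (FRAN.assocF X Y k)]
    exact (hintF.congr_fun heqF.symm hmF).union (hintR.congr_fun heqR.symm hmF.compl)
  have hrate : ∫ ω, Real.logb 2 (1 + FRAN.sinr PF PR α σ2 NB B X Y g h k ω) ∂μ =
      FRAN.probF lamF lamR k *
          (∫ ω, Real.logb 2 (1 + FRAN.sinrF PF PR α σ2 X Y g h ω)
            ∂(cond μ (FRAN.assocF X Y k))) +
        FRAN.probR lamF lamR k *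
          (∫ ω, Real.logb 2 (1 + FRAN.sinrR PF PR α σ2 NB B X Y g h ω)
            ∂(cond μ (FRAN.assocF X Y k)ᶜ)) := by
    rw [← integral_add_compl hmF hint, setIntegral_congr_fun hmF heqF,
      setIntegral_congr_fun hmF.compl heqR, FRAN.setIntegral_eq_mul_integral_cond hμF0,
      FRAN.setIntegral_eq_mul_integral_cond hμR0, hrF, hrR]
  have hrate' := hrate
  rw [hrateF, hrateR] at hrate'
  refine ⟨hregP.mono fun ω hω => ⟨hω.summable_X, hω.summable_Y, ?_, ?_⟩, hrF, hrR, hint, hrate,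
    hSF, hSR, hrateF, hrateR, hrate', ?_⟩
  · rw [FRAN.noiseF_eq]; exact hω.tagNoise_pos hPF.le hPR hσ2
  · rw [FRAN.noiseR_eq]; exact hω.symm.tagNoise_pos hυPR.le hPF hσ2
  rintro rfl
  have hcF := fun δ (hδ : 0 ≤ δ) =>
    hnet.successF_eq_closedF hlamF hlamR hPF hPR hk hα (δ := δ) hδ
  have hcR := fun δ (hδ : 0 ≤ δ) =>
    hnet.successR_eq_closedR (B := B) hlamF hlamR hPF hPR hk hα hNB (δ := δ) hδ
  have hδ : ∀ t ∈ Ioi (0 : ℝ), (0 : ℝ) ≤ 2 ^ t - 1 := fun t ht =>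
    sub_nonneg.2 (Real.one_le_rpow one_le_two (le_of_lt ht))
  refine ⟨fun δ hδ => ⟨hcF δ hδ, hcR δ hδ⟩, ?_⟩
  -- The closed forms are only available for `δ ≥ 0`, which `2 ^ t - 1` satisfies on the domain of
  -- integration.
  rw [← setIntegral_congr_fun measurableSet_Ioi fun t ht => hcF _ (hδ t ht),
    ← setIntegral_congr_fun measurableSet_Ioi fun t ht => hcR _ (hδ t ht)]
  exact hrate'
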